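/- Let $\sigma_0=\mathbb 1,\sigma_1,\sigma_2,\sigma_3$ be the identity and the Pauli matrices, and for $k=(\mu,\nu)\in\{0,1,2,3\}^2$ let $g_k=\tfrac12\,\sigma_\mu\otimes\sigma_\nu$, an operator on $\mathbb C^4$. A two-ququart state (a positive semidefinite, trace-one operator $\rho$ on $\mathbb C^4\otimes\mathbb C^4$, so that the total dimension is $d=16$) is *Bloch-diagonal* if $\rho=\sum_k x_k\,g_k\otimes g_k$ with real $x_k$. Let $\Gamma$ be the partial transposition, let $R(\rho)_{k,l}=\operatorname{tr}(\rho\,g_k\otimes g_l)$ be the realignment, and let $\|Y\|_1=\operatorname{tr}\sqrt{Y^\dagger Y}$. A radius $r\ge 0$ is *admissible* for $\rho$ if $$\text{(opt1)}\quad \lambda_{\min}[\Gamma(\rho)]\ge r\sqrt{(d-1)/d},\qquad \text{(opt2)}\quad \|R(\rho)\|_1>1+r\sqrt d ,$$ and $\rho$ has *maximal radius* $r$ if its set of admissible radii is nonempty and has supremum $r$. (The supremum need not be admissible itself, as (opt2) is strict.) A state is *bound entangled* if it is not separable and $\Gamma(\rho)\ge 0$; it is *detected by CCNR* if $\|R(\rho)\|_1>1$.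 Put $$s^*=\frac{4+3\sqrt{15}}{12\,(4+5\sqrt{15})}\approx 0.05571,\qquad r^*=\frac14\Bigl(15s^*-\frac34\Bigr)\approx 0.0214 .$$ 1. The largest maximal radius of a Bloch-diagonal two-ququart state is $r^*$. 2. The operator with $x_{00}=\tfrac14$, $x_k=s^*$ for $k\in\{01,02,03,10,11,12,20,21,23,31\}$ and $x_k=-s^*$ for the other five indices is a state with maximal radius $r^*$. So $r^*$ is attained by a state with $|x_k|=s^*$ for all $k\neq 00$. 3. The minimal rank of the Bloch-diagonal bound entangled states that are detected by CCNR and have maximal radius $r^*$ is $10$. 4. The minimal rank of the Bloch-diagonal bound entangled states that are detected by CCNR and have some admissible radius $r>0$ is $9$. Moreover, there is such a state of rank $9$ with maximal radius $\approx 0.0128$. Here $\approx$ means equality up to rounding in the last digit shown. -/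

import Mathlib

open scoped Kronecker ComplexOrder

noncomputable section

namespace BlochDiag

/-- The computational basis of one ququart, written as a pair of qubits. -/
abbrev Q : Type := Fin 2 × Fin 2

/-- Operators on one ququart. -/
abbrev Op : Type := Matrix Q Q ℂ

/-- Operators on two ququarts. -/
abbrev BiOp : Type := Matrix (Q × Q) (Q × Q) ℂ

/-- The identity and the three Pauli matrices. -/
def pauli : Fin 4 → Matrix (Fin 2) (Fin 2) ℂ :=
  ![1, !![0, 1; 1, 0], !![0, -Complex.I; Complex.I, 0], !![1, 0; 0, -1]]

/-- The Hermitian basis `g_k = (σ_μ ⊗ σ_ν) / 2`, with `k = (μ, ν)`; it is orthonormal for the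
Hilbert-Schmidt inner product. -/
def g (k : Fin 4 × Fin 4) : Op := (1 / 2 : ℂ) • (pauli k.1 ⊗ₖ pauli k.2)

/-- The Bloch-diagonal operator `∑_k x_k g_k ⊗ g_k`. -/
def blochDiagonal (x : Fin 4 × Fin 4 → ℝ) : BiOp := ∑ k, (x k : ℂ) • (g k ⊗ₖ g k)

/-- Density matrices. -/
def IsState {n : Type*} [Fintype n] (ρ : Matrix n n ℂ) : Prop := ρ.PosSemidef ∧ ρ.trace = 1

/-- Bloch-diagonal two-ququart states. -/
def IsBlochDiagonalState (ρ : BiOp) : Prop := IsState ρ ∧ ∃ x, ρ = blochDiagonal x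

/-- Partial transposition on the second ququart. -/
def partialTranspose (ρ : BiOp) : BiOp := Matrix.of fun i j => ρ (i.1, j.2) (j.1, i.2)

/-- The least eigenvalue of a Hermitian matrix (the minimum of its finite real spectrum). -/
def minEigenvalue {n : Type*} [Fintype n] [DecidableEq n] (A : Matrix n n ℂ) : ℝ :=
  sInf (spectrum ℝ A)

/-- The trace norm `tr √(Y† Y)`, with the square root taken by functional calculus. -/
def traceNorm {n : Type*} [Fintype n] [DecidableEq n] (Y : Matrix n n ℂ) : ℝ :=
  (cfc Real.sqrt (Y.conjTranspose * Y)).trace.re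

/-- The realignment `R(ρ)_{k,l} = tr (ρ (g_k ⊗ g_l))`. -/
def realignment (ρ : BiOp) : Matrix (Fin 4 × Fin 4) (Fin 4 × Fin 4) ℂ :=
  Matrix.of fun k l => (ρ * (g k ⊗ₖ g l)).trace

/-- Separable states: convex combinations of product states. -/
def IsSeparable (ρ : BiOp) : Prop :=
  ρ ∈ convexHull ℝ {τ : BiOp | ∃ a b : Op, IsState a ∧ IsState b ∧ τ = a ⊗ₖ b}

/-- Bound entangled states, understood as entangled states with positive partial transpose. -/
def IsBoundEntangled (ρ : BiOp) : Prop :=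
  IsState ρ ∧ (partialTranspose ρ).PosSemidef ∧ ¬ IsSeparable ρ

/-- Violation of the computable cross norm or realignment criterion. -/
def DetectedByCCNR (ρ : BiOp) : Prop := 1 < traceNorm (realignment ρ)

/-- The radii `r ≥ 0` admitted by `ρ`, where `d = 16` is the dimension of the two-ququart space:
`λ_min(Γ(ρ)) ≥ r √((d-1)/d)` and `‖R(ρ)‖₁ > 1 + r √d`. -/
def admissibleRadii (ρ : BiOp) : Set ℝ :=
  {r | 0 ≤ r ∧ r * √((16 - 1) / 16) ≤ minEigenvalue (partialTranspose ρ) ∧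
    1 + r * √16 < traceNorm (realignment ρ)}

/-- `r` is the maximal radius of `ρ`: the supremum of its (nonempty) set of admissible radii. -/
def HasMaximalRadius (ρ : BiOp) (r : ℝ) : Prop := IsLUB (admissibleRadii ρ) r

/-- `s* = (4 + 3 √15) / (12 (4 + 5 √15))`. -/
def sStar : ℝ := (4 + 3 * √15) / (12 * (4 + 5 * √15))

/-- `r* = (15 s* - 3/4) / 4`. -/
def rStar : ℝ := (15 * sStar - 3 / 4) / 4

/-- Coefficients of an optimal state: `1/4` at `(0,0)`, and `± s*` elsewhere. -/
def optimalCoeff (k : Fin 4 × Fin 4) : ℝ :=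
  if k = (0, 0) then 1 / 4
  else if k ∈ ({(0, 1), (0, 2), (0, 3), (1, 0), (1, 1), (1, 2), (2, 0), (2, 1), (2, 3), (3, 1)} :
    Finset (Fin 4 × Fin 4)) then sStar
  else -sStar

end BlochDiag

end

noncomputable section

namespace BlochDiag

/-! All `g_k ⊗ g_k` are diagonal in one basis, the product of two Bell bases, and partial
transposition flips the sign of those `x_k` whose index `k` contains exactly one 2. The realignment
is diagonal with entries `x_k`. Hence positivity, the condition on the least eigenvalue and the
trace norm become statements about 16 eigenvalues `λ_j`, 16 eigenvalues `μ_j` of the partial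
transpose, and `∑ |x_k|`.

Maximal radius. The 15 coefficients with `k ≠ 00` are placed on the edges of the complete graph on
six vertices. For these weights, cuts by even subsets have form `32 λ - 2` and cuts by odd subsets
have form `2 - 32 μ` (`form_evenCut`, `form_oddCut`). With `t = 12 s*`, the claim becomes that the
absolute edge weights, summed over ordered pairs, are at most `10 t`. This is a maximum of linear
programs over sign patterns. Permutations of the vertices and switching by even subsets preserve the
constraints, so a descent on normalised patterns leaves 43 of them (`PatternBound.of_irreducible`).
For 42 of these a combination of cut inequalities gives a strict bound (`patternBound_of_mem`). The
remaining one is the sign pattern of the symmetric conference matrix of order six: vertex 0 joined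
positively to a pentagon of negative edges with positive diagonals. There ten odd cuts add up to the
bound.

Rank ten. At an optimum these ten odd cuts are tight, which leaves at most six tight even cuts up to
complement, hence at most six zero eigenvalues (`patternBound_optimal`, `sum_abs_le`).

Rank nine. Arranged in a 4 × 4 grid, the `λ_j` form a probability distribution, and each `μ`
measures how far the weight of a cross is below one half (`cross_eq`). Eight zeros contain a
rectangle or a transversal, and either one forces a cross of weight at least one half
(`sum_zeros_lt`).

Explicit coefficients attain all three extremes. Entanglement comes from the realignment criterion
(`sum_abs_le_of_isSeparable`). -/

/-! ### Signed cut forms on the complete graph with six vertices -/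

/-- The sign `-1` for `true`, `1` for `false`. -/
def sg (b : Bool) : ℝ := bif b then -1 else 1

@[simp] lemma sg_true : sg true = -1 := rfl

@[simp] lemma sg_false : sg false = 1 := rfl

lemma sg_xor (a b : Bool) : sg (a ^^ b) = sg a * sg b := by cases a <;> cases b <;> simp

lemma sg_mul_self (a : Bool) : sg a * sg a = 1 := by cases a <;> simp

/-- The sum of the edge weights `y` of the complete graph on six vertices, taken over ordered pairs,
with the signs given by `h`. -/
def pairing (y : Fin 6 → Fin 6 → ℝ) (h : ℕ → ℕ → Bool) : ℝ := ∑ a : Fin 6, ∑ b : Fin 6,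
    sg (h a b) * y a b

/-- The signed cut form: edges crossing the cut `u` are counted with a minus sign. -/
def form (y : Fin 6 → Fin 6 → ℝ) (u : Fin 6 → Bool) : ℝ := ∑ a, ∑ b, sg (u a ^^ u b) * y a b

/-- The parity of a subset of the six vertices. -/
def parity (u : Fin 6 → Bool) : Bool := u 0 ^^ u 1 ^^ u 2 ^^ u 3 ^^ u 4 ^^ u 5

/-- Edge weights whose even cut forms are bounded below and whose odd cut forms are bounded
above. -/
structure CutBounds (t : ℝ) (y : Fin 6 → Fin 6 → ℝ) : Prop where
  symm : ∀ a b, y a b = y b a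
  diag : ∀ a, y a a = 0
  even : ∀ u, parity u = false → -2 ≤ form y u
  odd : ∀ u, parity u = true → form y u ≤ 2 * t

/-- The number of even subsets at which the lower bound of the cut form is attained. -/
def tightCount (y : Fin 6 → Fin 6 → ℝ) : ℕ :=
  (Finset.univ.filter fun u : Fin 6 → Bool => parity u = false ∧ form y u = -2).card

/-- The optimal bound for the sign pattern `h`, together with the bound on the number of tight
constraints in the case of equality. -/
def PatternBound (t : ℝ) (h : ℕ → ℕ → Bool) : Prop :=
  ∀ y, CutBounds t y → 10 * t ≤ pairing y h → pairing y h ≤ 10 * t ∧ tightCount y ≤ 12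

/-! ### Invariance under relabelling and even switching -/

lemma parity_swap : ∀ (i j : Fin 6) (u : Fin 6 → Bool), parity (u ∘ Equiv.swap i j) = parity u := by
  have key : ∀ (i j : Fin 6) (a b c d e f : Bool),
      parity (![a, b, c, d, e, f] ∘ Equiv.swap i j) = parity ![a, b, c, d, e,
          f] := by decide +kernel
  intro i j u
  have hu : u = ![u 0, u 1, u 2, u 3, u 4, u 5] := by
    funext k; fin_cases k <;> rfl
  rw [hu]
  exact key _ _ _ _ _ _ _ _

lemma form_swap (i j : Fin 6) (y : Fin 6 → Fin 6 → ℝ) (u : Fin 6 → Bool) :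
    form (fun a b => y (Equiv.swap i j a) (Equiv.swap i j b)) u = form y (u ∘ Equiv.swap i j) := by
  unfold form
  rw [← Equiv.sum_comp (Equiv.swap i j)]
  refine Finset.sum_congr rfl fun a _ => ?_
  rw [← Equiv.sum_comp (Equiv.swap i j)]
  simp

lemma tightCount_swap (i j : Fin 6) (y : Fin 6 → Fin 6 → ℝ) :
    tightCount (fun a b => y (Equiv.swap i j a) (Equiv.swap i j b)) = tightCount y := by
  unfold tightCount
  refine Finset.card_bij (fun u _ => u ∘ Equiv.swap i j) ?_ ?_ ?_
  · intro u hu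
    simpa [parity_swap, form_swap] using hu
  · intro u _ v _ h
    exact (Equiv.swap i j).surjective.injective_comp_right h
  · intro u hu
    refine ⟨u ∘ Equiv.swap i j, ?_, ?_⟩
    · have h2 : (u ∘ Equiv.swap i j) ∘ Equiv.swap i j = u := by funext k; simp
      simpa [parity_swap, form_swap, h2] using hu
    · funext k; simp

lemma PatternBound.of_swap {t : ℝ} {h h' : ℕ → ℕ → Bool} (i j : Fin 6)
    (e : ∀ a b : Fin 6, h' a b = h (Equiv.swap i j a) (Equiv.swap i j b))
    (H : PatternBound t h') : PatternBound t h := by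
  intro y hy hl
  have hp : pairing (fun a b => y (Equiv.swap i j a) (Equiv.swap i j b)) h' = pairing y h := by
    unfold pairing
    rw [← Equiv.sum_comp (Equiv.swap i j)]
    refine Finset.sum_congr rfl fun a _ => ?_
    rw [← Equiv.sum_comp (Equiv.swap i j)]
    simp [e]
  have := H (fun a b => y (Equiv.swap i j a) (Equiv.swap i j b))
    ⟨fun a b => hy.symm _ _, fun a => hy.diag _,
      fun u hu => by rw [form_swap]; exact hy.even _ (by rwa [parity_swap]),
      fun u hu => by rw [form_swap]; exact hy.odd _ (by rwa [parity_swap])⟩ (by rwa [hp])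
  rwa [hp, tightCount_swap] at this

lemma form_switch (v : Fin 6 → Bool) (y : Fin 6 → Fin 6 → ℝ) (u : Fin 6 → Bool) :
    form (fun a b => sg (v a ^^ v b) * y a b) u = form y fun a => u a ^^ v a := by
  unfold form
  refine Finset.sum_congr rfl fun a _ => Finset.sum_congr rfl fun b _ => ?_
  simp only [sg_xor]; ring

lemma parity_xor (u v : Fin 6 → Bool) : parity (fun a => u a ^^ v a) = (parity u ^^ parity v) := by
  simp only [parity, Bool.xor_assoc, Bool.xor_left_comm, Bool.xor_comm]

lemma tightCount_switch (v : Fin 6 → Bool) (hv : parity v = false) (y : Fin 6 → Fin 6 → ℝ) :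
    tightCount (fun a b => sg (v a ^^ v b) * y a b) = tightCount y := by
  unfold tightCount
  have h2 : ∀ u : Fin 6 → Bool, (fun a => (u a ^^ v a) ^^ v a) = u := fun u => by
    funext k; simp
  refine Finset.card_bij (fun u _ a => u a ^^ v a) ?_ ?_ ?_
  · intro u hu
    simpa [parity_xor, form_switch, hv] using hu
  · intro u _ w _ h
    have := congrArg (fun (z : Fin 6 → Bool) a => z a ^^ v a) h
    simpa [h2] using this
  · intro u hu
    refine ⟨fun a => u a ^^ v a, ?_, h2 u⟩
    simpa [parity_xor, form_switch, h2, hv] using hu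

/-- Multiplying each edge by its sign across the cut `v` moves the form at `u` to the form at the
symmetric difference of `u` and `v`. Since `v` is even, even and odd subsets are not mixed, so the
lower and the upper bounds are each preserved. -/
lemma PatternBound.of_switch {t : ℝ} {h h' : ℕ → ℕ → Bool} (v : Fin 6 → Bool)
    (hv : parity v = false) (e : ∀ a b : Fin 6, h' a b = (h a b ^^ v a ^^ v b))
    (H : PatternBound t h') : PatternBound t h := by
  intro y hy hl
  have hp : pairing (fun a b => sg (v a ^^ v b) * y a b) h' = pairing y h := by
    unfold pairing
    refine Finset.sum_congr rfl fun a _ => Finset.sum_congr rfl fun b _ => ?_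
    rw [e]
    simp only [sg_xor]
    linear_combination sg (h a b) * y a b * (sg (v b) ^ 2 * sg_mul_self (v a) + sg_mul_self (v b))
  have := H (fun a b => sg (v a ^^ v b) * y a b)
    ⟨fun a b => by rw [hy.symm a b, Bool.xor_comm], fun a => by simp [hy.diag],
      fun u hu => by rw [form_switch]; exact hy.even _ (by simp [parity_xor, hu, hv]),
      fun u hu => by rw [form_switch]; exact hy.odd _ (by simp [parity_xor, hu, hv])⟩ (by rwa [hp])
  rwa [hp, tightCount_switch v hv] at this

/-! ### Binary codes of sign patterns and the descent to irreducible ones -/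

/-- The binary digit recording the sign of an edge; edges that are normalised to be positive get an
unused digit. -/
def edgeIndex (a b : ℕ) : ℕ :=
  -- The constant is a 6 × 6 table in base 16, read at position `6 a + b`. The entry 15 marks the
  -- diagonal and the edges 01, 02, 03, 04; binary digit 15 of a code below 2048 is always zero.
  Nat.mod (Nat.shiftRight 20913554965386197695064521053668732600057855 (Nat.mul 4 (Nat.add (Nat.mul 6 a) b))) 16

/-- A binary digit of a natural number. -/
def digit (n i : ℕ) : Bool := Nat.beq 1 (Nat.land 1 (Nat.shiftRight n i))

lemma digit_eq (n i : ℕ) : digit n i = n.testBit i := by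
  have h : Nat.land 1 (Nat.shiftRight n i) = n >>> i % 2 := Nat.one_and_eq_mod_two _
  have h' : 1 &&& n >>> i = n >>> i % 2 := Nat.one_and_eq_mod_two _
  rw [digit, Nat.testBit, h, h']
  rcases Nat.mod_two_eq_zero_or_one (n >>> i) with e | e <;> rw [e] <;> rfl

/-- The sign pattern encoded by a natural number. -/
def pattern (n a b : ℕ) : Bool := digit n (edgeIndex a b)

/-- The even subset whose switching makes the edges at the vertex `0`, except the last one,
positive. -/
def normalizer (h : ℕ → ℕ → Bool) (a : ℕ) : Bool :=
  bif a.beq 0 then false else bif a.beq 5 then h 0 1 ^^ h 0 2 ^^ h 0 3 ^^ h 0 4 else h 0 a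

/-- The switched sign pattern. -/
def normalized (h : ℕ → ℕ → Bool) (a b : ℕ) : Bool := h a b ^^ normalizer h a ^^ normalizer h b

/-- The transposition of `i` and `j`. -/
def transpose (i j a : ℕ) : ℕ := bif a.beq i then j else bif a.beq j then i else a

/-- One step of a lexicographic comparison. -/
def lexStep (n : ℕ) (h : ℕ → ℕ → Bool) (a b i : ℕ) (k : Bool) : Bool :=
  bif normalized h a b ^^ digit n i then digit n i else k

/-- The normalised pattern of `h` is lexicographically smaller than that of `n`. -/
def lexBelow (n : ℕ) (h : ℕ → ℕ → Bool) : Bool :=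
  lexStep n h 0 5 10 <| lexStep n h 1 2 9 <| lexStep n h 1 3 8 <| lexStep n h 1 4 7 <|
  lexStep n h 1 5 6 <| lexStep n h 2 3 5 <| lexStep n h 2 4 4 <| lexStep n h 2 5 3 <|
  lexStep n h 3 4 2 <| lexStep n h 3 5 1 <| lexStep n h 4 5 0 false

/-- Transposing `i` and `j` makes the pattern of `n` smaller. -/
def improves (n i j : ℕ) : Bool :=
  lexBelow n fun a b => pattern n (transpose i j a) (transpose i j b)

/-- Some transposition makes the pattern of `n` smaller. -/
def reducible (n : ℕ) : Bool :=
  improves n 3 4 || improves n 3 5 || improves n 4 5 || improves n 0 1 || improves n 0 2 ||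
  improves n 0 3 || improves n 0 4 || improves n 0 5 || improves n 1 2 || improves n 1 3 ||
  improves n 1 4 || improves n 1 5 || improves n 2 3 || improves n 2 4 || improves n 2 5

/-- The irreducible patterns, except the optimal one. -/
def irreducibles : List ℕ :=
  [0, 1, 3, 7, 11, 12, 13, 15, 30, 31, 63, 75, 76, 77, 79, 84, 85, 86, 87, 94, 95, 116, 117, 119,
      127, 225, 227, 230, 231, 235, 237, 238, 239, 507, 511, 1023, 1099, 1100, 1109, 1184, 1191,
      1972]

/-- Exhaustive check of the 2048 codes, written as `1024 a + 32 b + c` so that each quantifier has a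
short range. -/
lemma reducible_or_mem : ∀ a < 2, ∀ b < 32, ∀ c < 32,
    (reducible (1024 * a + 32 * b + c) || Nat.beq (1024 * a + 32 * b + c) 236 ||
      irreducibles.any (Nat.beq (1024 * a + 32 * b + c))) = true := by
  decide +kernel

lemma reducible_or {n : ℕ} (hn : n < 2048) : reducible n = true ∨ n = 236 ∨ n ∈ irreducibles := by
  have h := reducible_or_mem (n / 1024) (by omega) (n / 32 % 32) (by omega) (n % 32) (by omega)
  rw [show 1024 * (n / 1024) + 32 * (n / 32 % 32) + n % 32 = n by omega] at h
  simp only [Bool.or_eq_true, List.any_eq_true, Nat.beq_eq] at h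
  rcases h with (h | h) | ⟨m, h, rfl⟩
  exacts [Or.inl h, Or.inr (Or.inl h), Or.inr (Or.inr h)]

/-- The signs of the eleven edges that are not normalised. -/
def normalizedDigits (h : ℕ → ℕ → Bool) : Fin 11 → Bool :=
  ![normalized h 4 5, normalized h 3 5, normalized h 3 4, normalized h 2 5, normalized h 2 4,
    normalized h 2 3, normalized h 1 5, normalized h 1 4, normalized h 1 3, normalized h 1 2,
    normalized h 0 5]

/-- The number encoding the normalised pattern of `h`. -/
def code (h : ℕ → ℕ → Bool) : ℕ := Nat.ofBits (normalizedDigits h)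

lemma testBit_code (h : ℕ → ℕ → Bool) (i : Fin 11) :
    (code h).testBit i = normalizedDigits h i := Nat.testBit_ofBits_lt _ _ i.2

lemma code_lt (h : ℕ → ℕ → Bool) : code h < 2048 := Nat.ofBits_lt_two_pow _

/-- The digit `i` decides the comparison of the residues modulo `2 ^ (i + 1)`, unless it agrees in
both numbers; then the residues modulo `2 ^ i`, recorded by `k`, decide. -/
lemma lexStep_lt {m n a b i : ℕ} {h : ℕ → ℕ → Bool} {k : Bool}
    (hi : m.testBit i = normalized h a b) (hk : k = true → m % 2 ^ i < n % 2 ^ i)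
    (H : lexStep n h a b i k = true) : m % 2 ^ (i + 1) < n % 2 ^ (i + 1) := by
  rw [lexStep, ← hi, digit_eq] at H
  rw [Nat.mod_pow_succ, Nat.mod_pow_succ, ← Nat.toNat_testBit, ← Nat.toNat_testBit]
  have h1 := Nat.mod_lt m (Nat.two_pow_pos i)
  have h2 := Nat.mod_lt n (Nat.two_pow_pos i)
  cases hm : m.testBit i <;> cases hn : n.testBit i <;> simp_all <;> omega

lemma code_lt_of_lexBelow {n : ℕ} (hn : n < 2048) {h : ℕ → ℕ → Bool} (H : lexBelow n h = true) :
    code h < n := by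
  have key : code h % 2 ^ 11 < n % 2 ^ 11 := by
    refine lexStep_lt (testBit_code h 10) (fun H => ?_) H
    refine lexStep_lt (testBit_code h 9) (fun H => ?_) H
    refine lexStep_lt (testBit_code h 8) (fun H => ?_) H
    refine lexStep_lt (testBit_code h 7) (fun H => ?_) H
    refine lexStep_lt (testBit_code h 6) (fun H => ?_) H
    refine lexStep_lt (testBit_code h 5) (fun H => ?_) H
    refine lexStep_lt (testBit_code h 4) (fun H => ?_) H
    refine lexStep_lt (testBit_code h 3) (fun H => ?_) H
    refine lexStep_lt (testBit_code h 2) (fun H => ?_) H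
    refine lexStep_lt (testBit_code h 1) (fun H => ?_) H
    exact lexStep_lt (testBit_code h 0) (fun H => by simp at H) H
  have := code_lt h
  omega

lemma pattern_symm (n : ℕ) : ∀ a b : Fin 6, pattern n a b = pattern n b a := by
  have : ∀ a b : Fin 6, edgeIndex a b = edgeIndex b a := by decide +kernel
  intro a b
  rw [pattern, this]; rfl

lemma testBit_fifteen {n : ℕ} (hn : n < 2048) : n.testBit 15 = false :=
  Nat.testBit_lt_two_pow (by omega)

lemma pattern_diag {n : ℕ} (hn : n < 2048) (a : Fin 6) : pattern n a a = false := by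
  have : ∀ a : Fin 6, edgeIndex a a = 15 := by decide +kernel
  rw [pattern, this, digit_eq, testBit_fifteen hn]

lemma pattern_code {h : ℕ → ℕ → Bool} (hs : ∀ a b : Fin 6, h a b = h b a)
    (hd : ∀ a : Fin 6, h a a = false) (a b : Fin 6) :
    pattern (code h) a b = normalized h a b := by
  have hlt : ∀ a b : Fin 6, a < b → pattern (code h) a b = normalized h a b := by
    have h15 := testBit_fifteen (code_lt h)
    have e0 : normalizer h 0 = false := rfl
    have e1 : normalizer h 1 = h 0 1 := rfl
    have e2 : normalizer h 2 = h 0 2 := rfl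
    have e3 : normalizer h 3 = h 0 3 := rfl
    have e4 : normalizer h 4 = h 0 4 := rfl
    intro a b hab
    rw [pattern, digit_eq]
    have hi := testBit_code h
    fin_cases a <;> fin_cases b <;> first
      | exact absurd hab (by decide)
      | exact h15.trans (by simp [normalized, e0, e1, e2, e3, e4])
      | exact hi 0
      | exact hi 1
      | exact hi 2
      | exact hi 3
      | exact hi 4
      | exact hi 5
      | exact hi 6
      | exact hi 7
      | exact hi 8
      | exact hi 9
      | exact hi 10
  rcases lt_trichotomy a b with hab | rfl | hab
  · exact hlt a b hab
  · rw [pattern_diag (code_lt h), normalized, hd]; simp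
  · rw [pattern_symm, hlt b a hab, normalized, normalized, hs a b, Bool.xor_assoc, Bool.xor_assoc,
      Bool.xor_comm (normalizer h b)]

lemma parity_normalizer (h : ℕ → ℕ → Bool) : parity (fun a => normalizer h a) = false := by
  have : ∀ a b c d : Bool, (false ^^ a ^^ b ^^ c ^^ d ^^ (a ^^ b ^^ c ^^ d)) = false := by decide
  exact this _ _ _ _

lemma PatternBound.of_code {t : ℝ} {h : ℕ → ℕ → Bool} (hs : ∀ a b : Fin 6, h a b = h b a)
    (hd : ∀ a : Fin 6, h a a = false) (H : PatternBound t (pattern (code h))) :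
    PatternBound t h :=
  PatternBound.of_switch (fun a => normalizer h a) (parity_normalizer h)
    (fun a b => pattern_code hs hd a b) H

lemma transpose_eq : ∀ i j a : Fin 6, transpose i j a = (Equiv.swap i j a : Fin 6) := by
  decide +kernel

/-- The descent step: transposing two vertices and normalising again yields an equivalent pattern
with a smaller code, to which the induction hypothesis applies. -/
lemma PatternBound.of_improves {t : ℝ} {n : ℕ} (hn : n < 2048)
    (H : ∀ m < n, PatternBound t (pattern m)) (i j : Fin 6) (hij : improves n i j = true) :
    PatternBound t (pattern n) := by
  refine PatternBound.of_swap i j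
    (h' := fun a b => pattern n (transpose i j a) (transpose i j b))
    (fun a b => by simp only [transpose_eq]) (PatternBound.of_code (fun a b => ?_) (fun a => ?_)
      (H _ (code_lt_of_lexBelow hn hij)))
  · simp only [transpose_eq, pattern_symm n (Equiv.swap i j a)]
  · simp only [transpose_eq, pattern_diag hn]

lemma PatternBound.of_irreducible {t : ℝ} (h0 : PatternBound t (pattern 236))
    (h1 : ∀ n ∈ irreducibles, PatternBound t (pattern n)) :
    ∀ n < 2048, PatternBound t (pattern n) := by
  intro n
  induction n using Nat.strong_induction_on with
  | _ n ih =>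
    intro hn
    have H : ∀ m < n, PatternBound t (pattern m) := fun m hm => ih m hm (hm.trans hn)
    rcases reducible_or hn with h | rfl | h
    · have hi := PatternBound.of_improves hn H
      simp only [reducible, Bool.or_eq_true] at h
      rcases h with (((((((((((((h | h) | h) | h) | h) | h) | h) | h) | h) | h) | h) | h) | h) | h) | h
      exacts [hi 3 4 h, hi 3 5 h, hi 4 5 h, hi 0 1 h, hi 0 2 h, hi 0 3 h, hi 0 4 h, hi 0 5 h,
        hi 1 2 h, hi 1 3 h, hi 1 4 h, hi 1 5 h, hi 2 3 h, hi 2 4 h, hi 2 5 h]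
    · exact h0
    · exact h1 n h

/-- The sum of the absolute values of the weights obeys the optimal bound as soon as the optimal
bound holds for the irreducible sign patterns. -/
lemma sum_abs_bound {t : ℝ} (H : ∀ n < 2048, PatternBound t (pattern n))
    {y : Fin 6 → Fin 6 → ℝ} (hy : CutBounds t y) (hl : 10 * t ≤ ∑ a, ∑ b, |y a b|) :
    ∑ a, ∑ b, |y a b| ≤ 10 * t ∧ tightCount y ≤ 12 := by
  -- For the sign pattern of `y` itself the pairing is the sum of absolute values; zero weights
  -- count as positive.
  let h : ℕ → ℕ → Bool := fun a b => decide (y (Fin.ofNat 6 a) (Fin.ofNat 6 b) < 0)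
  have hh : ∀ a b : Fin 6, h a b = decide (y a b < 0) := fun a b => by simp [h]
  have hp : pairing y h = ∑ a, ∑ b, |y a b| := by
    refine Finset.sum_congr rfl fun a _ => Finset.sum_congr rfl fun b _ => ?_
    rw [hh]
    by_cases hab : y a b < 0
    · simp [hab, abs_of_neg hab]
    · simp [hab, abs_of_nonneg (not_lt.1 hab)]
  have := PatternBound.of_code (fun a b => by rw [hh, hh, hy.symm]) (fun a => by simp [hh, hy.diag])
    (H _ (code_lt h)) y hy (by rwa [hp])
  rwa [hp] at this

/-! ### The cut inequalities in coordinates -/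

lemma sg_digit (n i : ℕ) : sg (digit n i) = if n / 2 ^ i % 2 = 1 then -1 else 1 := by
  rw [digit_eq, Nat.testBit_eq_decide_div_mod_eq]
  by_cases h : n / 2 ^ i % 2 = 1 <;> simp [h]

lemma form_eq {y : Fin 6 → Fin 6 → ℝ} (hs : ∀ a b, y a b = y b a) (hd : ∀ a, y a a = 0)
    (u : Fin 6 → Bool) : form y u = 2 * (sg (u 0 ^^ u 1) * y 0 1 + sg (u 0 ^^ u 2) * y 0 2 +
        sg (u 0 ^^ u 3) * y 0 3 +
      sg (u 0 ^^ u 4) * y 0 4 + sg (u 0 ^^ u 5) * y 0 5 + sg (u 1 ^^ u 2) * y 1 2 +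
      sg (u 1 ^^ u 3) * y 1 3 + sg (u 1 ^^ u 4) * y 1 4 + sg (u 1 ^^ u 5) * y 1 5 +
      sg (u 2 ^^ u 3) * y 2 3 + sg (u 2 ^^ u 4) * y 2 4 + sg (u 2 ^^ u 5) * y 2 5 +
      sg (u 3 ^^ u 4) * y 3 4 + sg (u 3 ^^ u 5) * y 3 5 + sg (u 4 ^^ u 5) * y 4 5) := by
  simp only [form, Fin.sum_univ_six, hd, sg_xor]
  rw [hs 1 0, hs 2 0, hs 3 0, hs 4 0, hs 5 0, hs 2 1, hs 3 1, hs 4 1, hs 5 1, hs 3 2, hs 4 2,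
      hs 5 2, hs 4 3, hs 5 3, hs 5 4]
  ring

lemma form_vec {y : Fin 6 → Fin 6 → ℝ} (hs : ∀ a b, y a b = y b a) (hd : ∀ a, y a a = 0)
    (u0 u1 u2 u3 u4 u5 : Bool) : form y ![u0, u1, u2, u3, u4, u5] = 2 * (sg (u0 ^^ u1) * y 0 1 +
        sg (u0 ^^ u2) * y 0 2 + sg (u0 ^^ u3) * y 0 3 +
      sg (u0 ^^ u4) * y 0 4 + sg (u0 ^^ u5) * y 0 5 + sg (u1 ^^ u2) * y 1 2 +
      sg (u1 ^^ u3) * y 1 3 + sg (u1 ^^ u4) * y 1 4 + sg (u1 ^^ u5) * y 1 5 +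
      sg (u2 ^^ u3) * y 2 3 + sg (u2 ^^ u4) * y 2 4 + sg (u2 ^^ u5) * y 2 5 +
      sg (u3 ^^ u4) * y 3 4 + sg (u3 ^^ u5) * y 3 5 + sg (u4 ^^ u5) * y 4 5) :=
  form_eq hs hd _

/-- The bounds for the cut forms, written out in the fifteen edge weights. -/
structure CutInequalities (t y01 y02 y03 y04 y05 y12 y13 y14 y15 y23 y24 y25 y34 y35 y45 :
    ℝ) : Prop where
  e0 : -1 ≤ y01 + y02 + y03 + y04 + y05 + y12 + y13 + y14 + y15 + y23 + y24 + y25 + y34 + y35 + y45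
  e1 : -1 ≤ y01 - y02 - y03 - y04 - y05 - y12 - y13 - y14 - y15 + y23 + y24 + y25 + y34 + y35 + y45
  e2 : -1 ≤ -y01 + y02 - y03 - y04 - y05 - y12 + y13 + y14 + y15 - y23 - y24 - y25 + y34 + y35 + y45
  e3 : -1 ≤ -y01 - y02 + y03 - y04 - y05 + y12 - y13 + y14 + y15 - y23 + y24 + y25 - y34 - y35 + y45
  e4 : -1 ≤ -y01 - y02 - y03 + y04 - y05 + y12 + y13 - y14 + y15 + y23 - y24 + y25 - y34 + y35 - y45
  e5 : -1 ≤ -y01 - y02 - y03 - y04 + y05 + y12 + y13 + y14 - y15 + y23 + y24 - y25 + y34 - y35 - y45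
  e6 : -1 ≤ -y01 - y02 + y03 + y04 + y05 + y12 - y13 - y14 - y15 - y23 - y24 - y25 + y34 + y35 + y45
  e7 : -1 ≤ -y01 + y02 - y03 + y04 + y05 - y12 + y13 - y14 - y15 - y23 + y24 + y25 - y34 - y35 + y45
  e8 : -1 ≤ -y01 + y02 + y03 - y04 + y05 - y12 - y13 + y14 - y15 + y23 - y24 + y25 - y34 + y35 - y45
  e9 : -1 ≤ -y01 + y02 + y03 + y04 - y05 - y12 - y13 - y14 + y15 + y23 + y24 - y25 + y34 - y35 - y45
  e10 : -1 ≤ y01 - y02 - y03 + y04 + y05 - y12 - y13 + y14 + y15 + y23 - y24 - y25 - y34 - y35 + y45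
  e11 : -1 ≤ y01 - y02 + y03 - y04 + y05 - y12 + y13 - y14 + y15 - y23 + y24 - y25 - y34 + y35 - y45
  e12 : -1 ≤ y01 - y02 + y03 + y04 - y05 - y12 + y13 + y14 - y15 - y23 - y24 + y25 + y34 - y35 - y45
  e13 : -1 ≤ y01 + y02 - y03 - y04 + y05 + y12 - y13 - y14 + y15 - y23 - y24 + y25 + y34 - y35 - y45
  e14 : -1 ≤ y01 + y02 - y03 + y04 - y05 + y12 - y13 + y14 - y15 - y23 + y24 - y25 - y34 + y35 - y45
  e15 : -1 ≤ y01 + y02 + y03 - y04 - y05 + y12 + y13 - y14 - y15 + y23 - y24 - y25 - y34 - y35 + y45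
  o0 : -y01 - y02 - y03 - y04 - y05 + y12 + y13 + y14 + y15 + y23 + y24 + y25 + y34 + y35 + y45 ≤ t
  o1 : -y01 + y02 + y03 + y04 + y05 - y12 - y13 - y14 - y15 + y23 + y24 + y25 + y34 + y35 + y45 ≤ t
  o2 : y01 - y02 + y03 + y04 + y05 - y12 + y13 + y14 + y15 - y23 - y24 - y25 + y34 + y35 + y45 ≤ t
  o3 : y01 + y02 - y03 + y04 + y05 + y12 - y13 + y14 + y15 - y23 + y24 + y25 - y34 - y35 + y45 ≤ t
  o4 : y01 + y02 + y03 - y04 + y05 + y12 + y13 - y14 + y15 + y23 - y24 + y25 - y34 + y35 - y45 ≤ t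
  o5 : y01 + y02 + y03 + y04 - y05 + y12 + y13 + y14 - y15 + y23 + y24 - y25 + y34 - y35 - y45 ≤ t
  o6 : y01 + y02 - y03 - y04 - y05 + y12 - y13 - y14 - y15 - y23 - y24 - y25 + y34 + y35 + y45 ≤ t
  o7 : y01 - y02 + y03 - y04 - y05 - y12 + y13 - y14 - y15 - y23 + y24 + y25 - y34 - y35 + y45 ≤ t
  o8 : y01 - y02 - y03 + y04 - y05 - y12 - y13 + y14 - y15 + y23 - y24 + y25 - y34 + y35 - y45 ≤ t
  o9 : y01 - y02 - y03 - y04 + y05 - y12 - y13 - y14 + y15 + y23 + y24 - y25 + y34 - y35 - y45 ≤ t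
  o10 : -y01 + y02 + y03 - y04 - y05 - y12 - y13 + y14 + y15 + y23 - y24 - y25 - y34 - y35 + y45 ≤ t
  o11 : -y01 + y02 - y03 + y04 - y05 - y12 + y13 - y14 + y15 - y23 + y24 - y25 - y34 + y35 - y45 ≤ t
  o12 : -y01 + y02 - y03 - y04 + y05 - y12 + y13 + y14 - y15 - y23 - y24 + y25 + y34 - y35 - y45 ≤ t
  o13 : -y01 - y02 + y03 + y04 - y05 + y12 - y13 - y14 + y15 - y23 - y24 + y25 + y34 - y35 - y45 ≤ t
  o14 : -y01 - y02 + y03 - y04 + y05 + y12 - y13 + y14 - y15 - y23 + y24 - y25 - y34 + y35 - y45 ≤ t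
  o15 : -y01 - y02 - y03 + y04 + y05 + y12 + y13 - y14 - y15 + y23 - y24 - y25 - y34 - y35 + y45 ≤ t

lemma CutBounds.inequalities {t : ℝ} {y : Fin 6 → Fin 6 → ℝ} (hy : CutBounds t y) :
    CutInequalities t (y 0 1) (y 0 2) (y 0 3) (y 0 4) (y 0 5)
      (y 1 2) (y 1 3) (y 1 4) (y 1 5) (y 2 3) (y 2 4) (y 2 5) (y 3 4) (y 3 5) (y 4 5) where
  e0 := by
    have h := hy.even ![false, false, false, false, false, false] rfl
    rw [form_vec hy.symm hy.diag] at h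
    norm_num at h; linarith
  e1 := by
    have h := hy.even ![true, true, false, false, false, false] rfl
    rw [form_vec hy.symm hy.diag] at h
    norm_num at h; linarith
  e2 := by
    have h := hy.even ![true, false, true, false, false, false] rfl
    rw [form_vec hy.symm hy.diag] at h
    norm_num at h; linarith
  e3 := by
    have h := hy.even ![true, false, false, true, false, false] rfl
    rw [form_vec hy.symm hy.diag] at h
    norm_num at h; linarith
  e4 := by
    have h := hy.even ![true, false, false, false, true, false] rfl
    rw [form_vec hy.symm hy.diag] at h
    norm_num at h; linarith
  e5 := by
    have h := hy.even ![true, false, false, false, false, true] rfl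
    rw [form_vec hy.symm hy.diag] at h
    norm_num at h; linarith
  e6 := by
    have h := hy.even ![false, true, true, false, false, false] rfl
    rw [form_vec hy.symm hy.diag] at h
    norm_num at h; linarith
  e7 := by
    have h := hy.even ![false, true, false, true, false, false] rfl
    rw [form_vec hy.symm hy.diag] at h
    norm_num at h; linarith
  e8 := by
    have h := hy.even ![false, true, false, false, true, false] rfl
    rw [form_vec hy.symm hy.diag] at h
    norm_num at h; linarith
  e9 := by
    have h := hy.even ![false, true, false, false, false, true] rfl
    rw [form_vec hy.symm hy.diag] at h
    norm_num at h; linarith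
  e10 := by
    have h := hy.even ![false, false, true, true, false, false] rfl
    rw [form_vec hy.symm hy.diag] at h
    norm_num at h; linarith
  e11 := by
    have h := hy.even ![false, false, true, false, true, false] rfl
    rw [form_vec hy.symm hy.diag] at h
    norm_num at h; linarith
  e12 := by
    have h := hy.even ![false, false, true, false, false, true] rfl
    rw [form_vec hy.symm hy.diag] at h
    norm_num at h; linarith
  e13 := by
    have h := hy.even ![false, false, false, true, true, false] rfl
    rw [form_vec hy.symm hy.diag] at h
    norm_num at h; linarith
  e14 := by
    have h := hy.even ![false, false, false, true, false, true] rfl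
    rw [form_vec hy.symm hy.diag] at h
    norm_num at h; linarith
  e15 := by
    have h := hy.even ![false, false, false, false, true, true] rfl
    rw [form_vec hy.symm hy.diag] at h
    norm_num at h; linarith
  o0 := by
    have h := hy.odd ![true, false, false, false, false, false] rfl
    rw [form_vec hy.symm hy.diag] at h
    norm_num at h; linarith
  o1 := by
    have h := hy.odd ![false, true, false, false, false, false] rfl
    rw [form_vec hy.symm hy.diag] at h
    norm_num at h; linarith
  o2 := by
    have h := hy.odd ![false, false, true, false, false, false] rfl
    rw [form_vec hy.symm hy.diag] at h
    norm_num at h; linarith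
  o3 := by
    have h := hy.odd ![false, false, false, true, false, false] rfl
    rw [form_vec hy.symm hy.diag] at h
    norm_num at h; linarith
  o4 := by
    have h := hy.odd ![false, false, false, false, true, false] rfl
    rw [form_vec hy.symm hy.diag] at h
    norm_num at h; linarith
  o5 := by
    have h := hy.odd ![false, false, false, false, false, true] rfl
    rw [form_vec hy.symm hy.diag] at h
    norm_num at h; linarith
  o6 := by
    have h := hy.odd ![true, true, true, false, false, false] rfl
    rw [form_vec hy.symm hy.diag] at h
    norm_num at h; linarith
  o7 := by
    have h := hy.odd ![true, true, false, true, false, false] rfl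
    rw [form_vec hy.symm hy.diag] at h
    norm_num at h; linarith
  o8 := by
    have h := hy.odd ![true, true, false, false, true, false] rfl
    rw [form_vec hy.symm hy.diag] at h
    norm_num at h; linarith
  o9 := by
    have h := hy.odd ![true, true, false, false, false, true] rfl
    rw [form_vec hy.symm hy.diag] at h
    norm_num at h; linarith
  o10 := by
    have h := hy.odd ![true, false, true, true, false, false] rfl
    rw [form_vec hy.symm hy.diag] at h
    norm_num at h; linarith
  o11 := by
    have h := hy.odd ![true, false, true, false, true, false] rfl
    rw [form_vec hy.symm hy.diag] at h
    norm_num at h; linarith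
  o12 := by
    have h := hy.odd ![true, false, true, false, false, true] rfl
    rw [form_vec hy.symm hy.diag] at h
    norm_num at h; linarith
  o13 := by
    have h := hy.odd ![true, false, false, true, true, false] rfl
    rw [form_vec hy.symm hy.diag] at h
    norm_num at h; linarith
  o14 := by
    have h := hy.odd ![true, false, false, true, false, true] rfl
    rw [form_vec hy.symm hy.diag] at h
    norm_num at h; linarith
  o15 := by
    have h := hy.odd ![true, false, false, false, true, true] rfl
    rw [form_vec hy.symm hy.diag] at h
    norm_num at h; linarith

lemma pairing_pattern {y : Fin 6 → Fin 6 → ℝ} (hs : ∀ a b, y a b = y b a) (hd : ∀ a, y a a = 0)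
    {n : ℕ} (hn : n < 2048) : pairing y (pattern n) = 2 * (y 0 1 + y 0 2 + y 0 3 + y 0 4 +
      sg (digit n 10) * y 0 5 + sg (digit n 9) * y 1 2 + sg (digit n 8) * y 1 3 +
      sg (digit n 7) * y 1 4 + sg (digit n 6) * y 1 5 + sg (digit n 5) * y 2 3 +
      sg (digit n 4) * y 2 4 + sg (digit n 3) * y 2 5 + sg (digit n 2) * y 3 4 +
      sg (digit n 1) * y 3 5 + sg (digit n 0) * y 4 5) := by
  have h15 : digit n 15 = false := by rw [digit_eq, testBit_fifteen hn]
  simp only [pairing, Fin.sum_univ_six, hd]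
  rw [hs 1 0, hs 2 0, hs 3 0, hs 4 0, hs 5 0, hs 2 1, hs 3 1, hs 4 1, hs 5 1, hs 3 2, hs 4 2,
      hs 5 2, hs 4 3, hs 5 3, hs 5 4]
  rw [pattern_symm n 1 0, pattern_symm n 2 0, pattern_symm n 3 0, pattern_symm n 4 0,
      pattern_symm n 5 0, pattern_symm n 2 1, pattern_symm n 3 1, pattern_symm n 4 1,
      pattern_symm n 5 1, pattern_symm n 3 2, pattern_symm n 4 2, pattern_symm n 5 2,
      pattern_symm n 4 3, pattern_symm n 5 3, pattern_symm n 5 4]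
  rw [show pattern n (0 : Fin 6) (1 : Fin 6) = digit n 15 from rfl]
  rw [show pattern n (0 : Fin 6) (2 : Fin 6) = digit n 15 from rfl]
  rw [show pattern n (0 : Fin 6) (3 : Fin 6) = digit n 15 from rfl]
  rw [show pattern n (0 : Fin 6) (4 : Fin 6) = digit n 15 from rfl]
  rw [show pattern n (0 : Fin 6) (5 : Fin 6) = digit n 10 from rfl]
  rw [show pattern n (1 : Fin 6) (2 : Fin 6) = digit n 9 from rfl]
  rw [show pattern n (1 : Fin 6) (3 : Fin 6) = digit n 8 from rfl]
  rw [show pattern n (1 : Fin 6) (4 : Fin 6) = digit n 7 from rfl]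
  rw [show pattern n (1 : Fin 6) (5 : Fin 6) = digit n 6 from rfl]
  rw [show pattern n (2 : Fin 6) (3 : Fin 6) = digit n 5 from rfl]
  rw [show pattern n (2 : Fin 6) (4 : Fin 6) = digit n 4 from rfl]
  rw [show pattern n (2 : Fin 6) (5 : Fin 6) = digit n 3 from rfl]
  rw [show pattern n (3 : Fin 6) (4 : Fin 6) = digit n 2 from rfl]
  rw [show pattern n (3 : Fin 6) (5 : Fin 6) = digit n 1 from rfl]
  rw [show pattern n (4 : Fin 6) (5 : Fin 6) = digit n 0 from rfl]
  simp only [h15, sg_false]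
  ring

lemma PatternBound.of_lt {t : ℝ} {n : ℕ} (hn : n < 2048)
    (H : ∀ y01 y02 y03 y04 y05 y12 y13 y14 y15 y23 y24 y25 y34 y35 y45 : ℝ,
      CutInequalities t y01 y02 y03 y04 y05 y12 y13 y14 y15 y23 y24 y25 y34 y35 y45 →
      y01 + y02 + y03 + y04 +
      sg (digit n 10) * y05 + sg (digit n 9) * y12 + sg (digit n 8) * y13 + sg (digit n 7) * y14 +
      sg (digit n 6) * y15 + sg (digit n 5) * y23 + sg (digit n 4) * y24 + sg (digit n 3) * y25 +
      sg (digit n 2) * y34 + sg (digit n 1) * y35 + sg (digit n 0) * y45 < 5 * t) :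
    PatternBound t (pattern n) := by
  intro y hy hl
  rw [pairing_pattern hy.symm hy.diag hn] at hl
  have := H _ _ _ _ _ _ _ _ _ _ _ _ _ _ _ hy.inequalities
  linarith

/-! ### Linear programming certificates for the non-optimal patterns -/

lemma patternBound_of_mem {t : ℝ} (ht : 0.6684 < t) (ht' : t < 0.6685) :
    ∀ n ∈ irreducibles, PatternBound t (pattern n) := by
  intro n hn
  refine PatternBound.of_lt ?_ ?_
  · have : ∀ n ∈ irreducibles, n < 2048 := by decide
    exact this n hn
  intro y01 y02 y03 y04 y05 y12 y13 y14 y15 y23 y24 y25 y34 y35 y45 H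
  simp only [irreducibles, List.mem_cons, List.not_mem_nil, or_false] at hn
  rcases hn with rfl | rfl | rfl | rfl | rfl | rfl | rfl | rfl | rfl | rfl | rfl | rfl | rfl | rfl |
    rfl | rfl | rfl | rfl | rfl | rfl | rfl | rfl | rfl | rfl | rfl | rfl | rfl | rfl |
    rfl | rfl | rfl | rfl | rfl | rfl | rfl | rfl | rfl | rfl | rfl | rfl | rfl | rfl
  all_goals norm_num [sg_digit]
  -- Each list names the cuts in a dual certificate. Here the six singleton cuts add up to twice the
  -- objective, which is therefore at most `3 t`. When even cuts occur, the bound mixes `1` and `t`,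
  -- and the numerical range of `t` makes it smaller than `5 t`.
  · linarith [H.o0, H.o1, H.o2, H.o3, H.o4, H.o5]
  · linarith [H.o0, H.o1, H.o2, H.o3, H.o4, H.o5, H.e15]
  · linarith [H.o3, H.o4, H.o5, H.e14, H.e15]
  · linarith [H.o0, H.o1, H.o2, H.o3, H.o4, H.o5, H.e1, H.e2, H.e6]
  · linarith [H.o0, H.o1, H.o2, H.o3, H.o4, H.o5, H.o9, H.e1]
  · linarith [H.o2, H.o3, H.o4, H.o5, H.e12, H.e13]
  · linarith [H.o2, H.o3, H.o4, H.o5, H.o8, H.o9, H.o11, H.o14, H.e1, H.e12, H.e13, H.e15]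
  · linarith [H.o3, H.o4, H.o5, H.o9, H.e1, H.e13]
  · linarith [H.o2, H.o3, H.o4, H.o5, H.o10, H.o15]
  · linarith [H.o2, H.o3, H.o4, H.o5, H.o8, H.o9, H.o10, H.o15, H.e1]
  · linarith [H.o2, H.o3, H.o4, H.o5, H.e0, H.e1]
  · linarith [H.o1, H.o2, H.o3, H.o4, H.o5, H.o9, H.o12, H.o14, H.o15]
  · linarith [H.o1, H.o2, H.o3, H.o4, H.o5, H.o6, H.o14, H.o15, H.e3, H.e4, H.e9, H.e12, H.e13]
  · linarith [H.o3, H.o4, H.o5, H.o14, H.e3, H.e13]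
  · linarith [H.o3, H.o4, H.o5, H.o14, H.o15, H.e1, H.e2, H.e3, H.e4, H.e6, H.e13]
  · linarith [H.o1, H.o2, H.o3, H.o4, H.o5, H.o8, H.o10, H.o15, H.e1, H.e5, H.e9, H.e11, H.e13]
  · linarith [H.o1, H.o4, H.o5, H.o8, H.e1, H.e9]
  · linarith [H.o1, H.o2, H.o3, H.o4, H.o5, H.o7, H.o8, H.o10, H.o12, H.o15, H.e1, H.e2, H.e9,
      H.e11]
  · linarith [H.o1, H.o2, H.o3, H.o4, H.o5, H.o7, H.o8, H.o10, H.o12, H.o15, H.e1, H.e2, H.e9,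
      H.e11]
  · linarith [H.o1, H.o2, H.o3, H.o4, H.o5, H.o8, H.o10, H.o15, H.e1, H.e4, H.e5, H.e9]
  · linarith [H.o4, H.o5, H.o8, H.o15, H.e1, H.e4]
  · linarith [H.o1, H.o5, H.e1, H.e5, H.e9]
  · linarith [H.o1, H.o2, H.o3, H.o4, H.o5, H.o8, H.o12, H.o14, H.e1, H.e2, H.e3, H.e5, H.e9, H.e10]
  · linarith [H.o5, H.o12, H.e1, H.e2, H.e5, H.e9]
  · linarith [H.o5, H.o6, H.o7, H.o8, H.e1, H.e2, H.e3, H.e4, H.e9]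
  · linarith [H.o2, H.o3, H.e2, H.e3, H.e10]
  · linarith [H.o1, H.o2, H.o3, H.o4, H.o5, H.o7, H.o12, H.o13, H.e1, H.e2, H.e3, H.e4, H.e8, H.e10]
  · linarith [H.o1, H.o2, H.o3, H.o4, H.o5, H.o6, H.o7, H.o15, H.e1, H.e2, H.e3, H.e10]
  · linarith [H.o3, H.o7, H.e1, H.e2, H.e3, H.e10]
  · linarith [H.e1, H.e2, H.e3, H.e4, H.e8, H.e10]
  · linarith [H.o1, H.o2, H.o3, H.o4, H.o5, H.o6, H.o7, H.o11, H.o14, H.o15, H.e1, H.e2, H.e3,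
      H.e10]
  · linarith [H.o1, H.o2, H.o3, H.o4, H.o5, H.o6, H.o7, H.o11, H.o14, H.o15, H.e1, H.e2, H.e4, H.e8]
  · linarith [H.o3, H.o4, H.o5, H.o6, H.o7, H.o11, H.o14, H.o15, H.e1, H.e2, H.e3, H.e4, H.e8,
      H.e10]
  · linarith [H.o6, H.o13, H.e1, H.e2, H.e3, H.e4]
  · linarith [H.o6, H.e0, H.e1, H.e2, H.e3, H.e4, H.e5]
  · linarith [H.e0, H.e1, H.e2, H.e3, H.e4, H.e5]
  · linarith [H.o5]
  · linarith [H.o3, H.o4, H.o5, H.o6, H.e13]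
  · linarith [H.o4, H.o5, H.o8, H.e1, H.e5, H.e9, H.e10, H.e11, H.e13]
  · linarith [H.o0, H.o1, H.o2, H.o3, H.o4, H.o5, H.e5, H.e8, H.e10]
  · linarith [H.o3, H.o4, H.o5, H.o7, H.o11, H.o13]
  · linarith [H.e5]

/-! ### The optimal pattern and its tight cuts -/

/-- The even subsets, up to complement, whose constraints can be tight at an optimum. -/
def tightCandidates : Fin 10 → Fin 6 → Bool :=
  ![![true, true, false, false, false, false],
    ![true, false, true, false, false, false],
    ![true, false, false, true, false, false],
    ![true, false, false, false, true, false],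
    ![true, false, false, false, false, true],
    ![false, true, false, false, true, false],
    ![false, true, false, false, false, true],
    ![false, false, true, true, false, false],
    ![false, false, true, false, false, true],
    ![false, false, false, true, true, false]]

/-- Up to complement, the candidates are the five pairs through vertex 0 and the five edges of the
negative pentagon. What remains is the empty set and the five diagonals of the pentagon. -/
lemma candidate_or_single : ∀ u : Fin 6 → Bool, parity u = false →
    (∃ i c, u = fun a => tightCandidates i a ^^ c) ∨
    ∃ c, (u = fun a => ![false, false, false, false, false, false] a ^^ c) ∨ (u = fun a => ![false,
        true, true, false, false, false] a ^^ c) ∨ (u = fun a => ![false, true, false, true, false,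
        false] a ^^ c) ∨ (u = fun a => ![false, false, true, false, true, false] a ^^ c) ∨
        (u = fun a => ![false, false, false, true, false, true] a ^^ c) ∨ (u = fun a => ![false,
        false, false, false, true, true] a ^^ c) := by
  have key : ∀ u0 u1 u2 u3 u4 u5 : Bool, parity ![u0, u1, u2, u3, u4, u5] = false →
    (∃ i c, ![u0, u1, u2, u3, u4, u5] = fun a => tightCandidates i a ^^ c) ∨ ∃ c, (![u0, u1, u2,
        u3, u4, u5] = fun a => ![false, false, false, false, false, false] a ^^ c) ∨ (![u0, u1, u2,
        u3, u4, u5] = fun a => ![false, true, true, false, false, false] a ^^ c) ∨ (![u0, u1, u2,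
        u3, u4, u5] = fun a => ![false, true, false, true, false, false] a ^^ c) ∨ (![u0, u1, u2,
        u3, u4, u5] = fun a => ![false, false, true, false, true, false] a ^^ c) ∨ (![u0, u1, u2,
        u3, u4, u5] = fun a => ![false, false, false, true, false, true] a ^^ c) ∨ (![u0, u1, u2,
        u3, u4, u5] = fun a => ![false, false, false, false, true, true] a ^^ c) := by
    decide +kernel
  intro u
  rw [show u = ![u 0, u 1, u 2, u 3, u 4, u 5] by funext k; fin_cases k <;> rfl]
  exact key _ _ _ _ _ _

lemma form_compl (y : Fin 6 → Fin 6 → ℝ) (u : Fin 6 → Bool) (c : Bool) :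
    form y (fun a => u a ^^ c) = form y u := by
  have : ∀ a b : Bool, ((a ^^ c) ^^ (b ^^ c)) = (a ^^ b) := by
    cases c <;> simp
  simp only [form, this]

/-- The hypotheses are the fifteen quadruples of candidate cuts that cannot be tight together; every
set of seven candidates contains one of them. -/
lemma count_le_six : ∀ b : Fin 10 → Bool,
    (b 0 && b 1 && b 4 && b 9) = false →
    (b 0 && b 1 && b 6 && b 8) = false →
    (b 0 && b 2 && b 3 && b 8) = false →
    (b 0 && b 2 && b 5 && b 9) = false →
    (b 0 && b 3 && b 4 && b 7) = false →
    (b 0 && b 5 && b 6 && b 7) = false →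
    (b 1 && b 2 && b 3 && b 6) = false →
    (b 1 && b 2 && b 4 && b 5) = false →
    (b 1 && b 3 && b 7 && b 9) = false →
    (b 1 && b 5 && b 7 && b 8) = false →
    (b 2 && b 4 && b 7 && b 8) = false →
    (b 2 && b 6 && b 7 && b 9) = false →
    (b 3 && b 4 && b 5 && b 6) = false →
    (b 3 && b 5 && b 8 && b 9) = false →
    (b 4 && b 6 && b 8 && b 9) = false →
    (Finset.univ.filter fun i => b i = true).card ≤ 6 := by
  have key : ∀ b0 b1 b2 b3 b4 b5 b6 b7 b8 b9 : Bool,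
      (b0 && b1 && b4 && b9) = false →
      (b0 && b1 && b6 && b8) = false →
      (b0 && b2 && b3 && b8) = false →
      (b0 && b2 && b5 && b9) = false →
      (b0 && b3 && b4 && b7) = false →
      (b0 && b5 && b6 && b7) = false →
      (b1 && b2 && b3 && b6) = false →
      (b1 && b2 && b4 && b5) = false →
      (b1 && b3 && b7 && b9) = false →
      (b1 && b5 && b7 && b8) = false →
      (b2 && b4 && b7 && b8) = false →
      (b2 && b6 && b7 && b9) = false →
      (b3 && b4 && b5 && b6) = false →
      (b3 && b5 && b8 && b9) = false →
      (b4 && b6 && b8 && b9) = false →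
      b0.toNat + b1.toNat + b2.toNat + b3.toNat + b4.toNat + b5.toNat + b6.toNat + b7.toNat +
        b8.toNat + b9.toNat ≤ 6 := by decide +kernel
  intro b h0 h1 h2 h3 h4 h5 h6 h7 h8 h9 h10 h11 h12 h13 h14
  have := key _ _ _ _ _ _ _ _ _ _ h0 h1 h2 h3 h4 h5 h6 h7 h8 h9 h10 h11 h12 h13 h14
  have e : ∀ i, (if b i = true then 1 else 0) = (b i).toNat := fun i => by cases b i <;> rfl
  rw [Finset.card_filter]
  simp only [e]
  rw [Fin.sum_univ_castSucc, Fin.sum_univ_castSucc, Fin.sum_univ_eight]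
  exact this

lemma tightCount_le {y : Fin 6 → Fin 6 → ℝ} (b : Fin 10 → Bool)
    (hb : (Finset.univ.filter fun i => b i = true).card ≤ 6)
    (H : ∀ u, parity u = false → form y u = -2 → ∃ i c, b i = true ∧
      u = fun a => tightCandidates i a ^^ c) : tightCount y ≤ 12 := by
  calc tightCount y ≤ (((Finset.univ.filter fun i => b i = true) ×ˢ
        (Finset.univ : Finset Bool)).image fun p a => tightCandidates p.1 a ^^ p.2).card := by
        refine Finset.card_le_card fun u hu => ?_
        obtain ⟨-, h1, h2⟩ := Finset.mem_filter.1 hu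
        obtain ⟨i, c, hi, rfl⟩ := H u h1 h2
        exact Finset.mem_image.2 ⟨(i, c), by simp [hi], rfl⟩
    _ ≤ _ := Finset.card_image_le
    _ ≤ 12 := by rw [Finset.card_product]; simp; omega

-- The code 236 has negative edges 14, 43, 32, 25, 51, a pentagon. The ten odd cuts used are the
-- singletons `{1}, …, {5}` and the triples made of 0 and a diagonal of the pentagon; their forms
-- add up to twice the pairing. Reaching `10 t` thus makes all ten tight. With these ten equations,
-- each of the fifteen quadruples of tight candidates is contradictory, and none of the six other
-- even cuts can be tight.
set_option maxHeartbeats 2000000 in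
lemma patternBound_optimal {t : ℝ} (ht : 0.6684 < t) (ht' : t < 0.6685) :
    PatternBound t (pattern 236) := by
  intro y hy hl
  have H := hy.inequalities
  have hp := pairing_pattern hy.symm hy.diag (n := 236) (by norm_num)
  norm_num [sg_digit] at hp
  rw [hp] at hl ⊢
  -- Ten upper bounds `t` whose sum is at least `10 t` by `hl`: each is an equality.
  have q1 : - y 0 1 + y 0 2 + y 0 3 + y 0 4 + y 0 5 - y 1 2 - y 1 3 - y 1 4 - y 1 5 + y 2 3 +
      y 2 4 + y 2 5 + y 3 4 + y 3 5 + y 4 5 = t := by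
    linarith [H.o1, H.o2, H.o3, H.o4, H.o5, H.o6, H.o7, H.o11, H.o14, H.o15]
  have q2 : y 0 1 - y 0 2 + y 0 3 + y 0 4 + y 0 5 - y 1 2 + y 1 3 + y 1 4 + y 1 5 - y 2 3 -
      y 2 4 - y 2 5 + y 3 4 + y 3 5 + y 4 5 = t := by
    linarith [H.o1, H.o2, H.o3, H.o4, H.o5, H.o6, H.o7, H.o11, H.o14, H.o15]
  have q3 : y 0 1 + y 0 2 - y 0 3 + y 0 4 + y 0 5 + y 1 2 - y 1 3 + y 1 4 + y 1 5 - y 2 3 +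
      y 2 4 + y 2 5 - y 3 4 - y 3 5 + y 4 5 = t := by
    linarith [H.o1, H.o2, H.o3, H.o4, H.o5, H.o6, H.o7, H.o11, H.o14, H.o15]
  have q4 : y 0 1 + y 0 2 + y 0 3 - y 0 4 + y 0 5 + y 1 2 + y 1 3 - y 1 4 + y 1 5 + y 2 3 -
      y 2 4 + y 2 5 - y 3 4 + y 3 5 - y 4 5 = t := by
    linarith [H.o1, H.o2, H.o3, H.o4, H.o5, H.o6, H.o7, H.o11, H.o14, H.o15]
  have q5 : y 0 1 + y 0 2 + y 0 3 + y 0 4 - y 0 5 + y 1 2 + y 1 3 + y 1 4 - y 1 5 + y 2 3 +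
      y 2 4 - y 2 5 + y 3 4 - y 3 5 - y 4 5 = t := by
    linarith [H.o1, H.o2, H.o3, H.o4, H.o5, H.o6, H.o7, H.o11, H.o14, H.o15]
  have q6 : y 0 1 + y 0 2 - y 0 3 - y 0 4 - y 0 5 + y 1 2 - y 1 3 - y 1 4 - y 1 5 - y 2 3 -
      y 2 4 - y 2 5 + y 3 4 + y 3 5 + y 4 5 = t := by
    linarith [H.o1, H.o2, H.o3, H.o4, H.o5, H.o6, H.o7, H.o11, H.o14, H.o15]
  have q7 : y 0 1 - y 0 2 + y 0 3 - y 0 4 - y 0 5 - y 1 2 + y 1 3 - y 1 4 - y 1 5 - y 2 3 +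
      y 2 4 + y 2 5 - y 3 4 - y 3 5 + y 4 5 = t := by
    linarith [H.o1, H.o2, H.o3, H.o4, H.o5, H.o6, H.o7, H.o11, H.o14, H.o15]
  have q11 : - y 0 1 + y 0 2 - y 0 3 + y 0 4 - y 0 5 - y 1 2 + y 1 3 - y 1 4 + y 1 5 - y 2 3 +
      y 2 4 - y 2 5 - y 3 4 + y 3 5 - y 4 5 = t := by
    linarith [H.o1, H.o2, H.o3, H.o4, H.o5, H.o6, H.o7, H.o11, H.o14, H.o15]
  have q14 : - y 0 1 - y 0 2 + y 0 3 - y 0 4 + y 0 5 + y 1 2 - y 1 3 + y 1 4 - y 1 5 - y 2 3 +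
      y 2 4 - y 2 5 - y 3 4 + y 3 5 - y 4 5 = t := by
    linarith [H.o1, H.o2, H.o3, H.o4, H.o5, H.o6, H.o7, H.o11, H.o14, H.o15]
  have q15 : - y 0 1 - y 0 2 - y 0 3 + y 0 4 + y 0 5 + y 1 2 + y 1 3 - y 1 4 - y 1 5 + y 2 3 -
      y 2 4 - y 2 5 - y 3 4 - y 3 5 + y 4 5 = t := by
    linarith [H.o1, H.o2, H.o3, H.o4, H.o5, H.o6, H.o7, H.o11, H.o14, H.o15]
  refine ⟨by linarith [H.o1, H.o2, H.o3, H.o4, H.o5, H.o6, H.o7, H.o11, H.o14, H.o15], ?_⟩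
  have f0 : form y (tightCandidates 0) = -2 → y 0 1 - y 0 2 - y 0 3 - y 0 4 - y 0 5 - y 1 2 -
      y 1 3 - y 1 4 - y 1 5 + y 2 3 + y 2 4 + y 2 5 + y 3 4 + y 3 5 + y 4 5 = -1 := fun h => by
    have h' := form_vec hy.symm hy.diag true true false false false false
    norm_num at h'
    change form y ![true, true, false, false, false, false] = -2 at h; linarith
  have f1 : form y (tightCandidates 1) = -2 → - y 0 1 + y 0 2 - y 0 3 - y 0 4 - y 0 5 - y 1 2 +
      y 1 3 + y 1 4 + y 1 5 - y 2 3 - y 2 4 - y 2 5 + y 3 4 + y 3 5 + y 4 5 = -1 := fun h => by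
    have h' := form_vec hy.symm hy.diag true false true false false false
    norm_num at h'
    change form y ![true, false, true, false, false, false] = -2 at h; linarith
  have f2 : form y (tightCandidates 2) = -2 → - y 0 1 - y 0 2 + y 0 3 - y 0 4 - y 0 5 + y 1 2 -
      y 1 3 + y 1 4 + y 1 5 - y 2 3 + y 2 4 + y 2 5 - y 3 4 - y 3 5 + y 4 5 = -1 := fun h => by
    have h' := form_vec hy.symm hy.diag true false false true false false
    norm_num at h'
    change form y ![true, false, false, true, false, false] = -2 at h; linarith
  have f3 : form y (tightCandidates 3) = -2 → - y 0 1 - y 0 2 - y 0 3 + y 0 4 - y 0 5 + y 1 2 +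
      y 1 3 - y 1 4 + y 1 5 + y 2 3 - y 2 4 + y 2 5 - y 3 4 + y 3 5 - y 4 5 = -1 := fun h => by
    have h' := form_vec hy.symm hy.diag true false false false true false
    norm_num at h'
    change form y ![true, false, false, false, true, false] = -2 at h; linarith
  have f4 : form y (tightCandidates 4) = -2 → - y 0 1 - y 0 2 - y 0 3 - y 0 4 + y 0 5 + y 1 2 +
      y 1 3 + y 1 4 - y 1 5 + y 2 3 + y 2 4 - y 2 5 + y 3 4 - y 3 5 - y 4 5 = -1 := fun h => by
    have h' := form_vec hy.symm hy.diag true false false false false true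
    norm_num at h'
    change form y ![true, false, false, false, false, true] = -2 at h; linarith
  have f5 : form y (tightCandidates 5) = -2 → - y 0 1 + y 0 2 + y 0 3 - y 0 4 + y 0 5 - y 1 2 -
      y 1 3 + y 1 4 - y 1 5 + y 2 3 - y 2 4 + y 2 5 - y 3 4 + y 3 5 - y 4 5 = -1 := fun h => by
    have h' := form_vec hy.symm hy.diag false true false false true false
    norm_num at h'
    change form y ![false, true, false, false, true, false] = -2 at h; linarith
  have f6 : form y (tightCandidates 6) = -2 → - y 0 1 + y 0 2 + y 0 3 + y 0 4 - y 0 5 - y 1 2 -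
      y 1 3 - y 1 4 + y 1 5 + y 2 3 + y 2 4 - y 2 5 + y 3 4 - y 3 5 - y 4 5 = -1 := fun h => by
    have h' := form_vec hy.symm hy.diag false true false false false true
    norm_num at h'
    change form y ![false, true, false, false, false, true] = -2 at h; linarith
  have f7 : form y (tightCandidates 7) = -2 → y 0 1 - y 0 2 - y 0 3 + y 0 4 + y 0 5 - y 1 2 -
      y 1 3 + y 1 4 + y 1 5 + y 2 3 - y 2 4 - y 2 5 - y 3 4 - y 3 5 + y 4 5 = -1 := fun h => by
    have h' := form_vec hy.symm hy.diag false false true true false false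
    norm_num at h'
    change form y ![false, false, true, true, false, false] = -2 at h; linarith
  have f8 : form y (tightCandidates 8) = -2 → y 0 1 - y 0 2 + y 0 3 + y 0 4 - y 0 5 - y 1 2 +
      y 1 3 + y 1 4 - y 1 5 - y 2 3 - y 2 4 + y 2 5 + y 3 4 - y 3 5 - y 4 5 = -1 := fun h => by
    have h' := form_vec hy.symm hy.diag false false true false false true
    norm_num at h'
    change form y ![false, false, true, false, false, true] = -2 at h; linarith
  have f9 : form y (tightCandidates 9) = -2 → y 0 1 + y 0 2 - y 0 3 - y 0 4 + y 0 5 + y 1 2 -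
      y 1 3 - y 1 4 + y 1 5 - y 2 3 - y 2 4 + y 2 5 + y 3 4 - y 3 5 - y 4 5 = -1 := fun h => by
    have h' := form_vec hy.symm hy.diag false false false true true false
    norm_num at h'
    change form y ![false, false, false, true, true, false] = -2 at h; linarith
  refine tightCount_le (fun i => decide (form y (tightCandidates i) = -2))
    (count_le_six _ ?_ ?_ ?_ ?_ ?_ ?_ ?_ ?_ ?_ ?_ ?_ ?_ ?_ ?_ ?_) fun u hu hf => ?_
  any_goals
    simp only [Bool.and_eq_false_imp, Bool.and_eq_true, decide_eq_true_eq, decide_eq_false_iff_not]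
  · rintro ⟨⟨h1, h2⟩, h3⟩ h4
    linarith [f0 h1, f1 h2, f4 h3, f9 h4, q1, q2, q3, q4, q5, q6, q7, q11, q14, q15]
  · rintro ⟨⟨h1, h2⟩, h3⟩ h4
    linarith [f0 h1, f1 h2, f6 h3, f8 h4, q1, q2, q3, q4, q5, q6, q7, q11, q14, q15]
  · rintro ⟨⟨h1, h2⟩, h3⟩ h4
    linarith [f0 h1, f2 h2, f3 h3, f8 h4, q1, q2, q3, q4, q5, q6, q7, q11, q14, q15]
  · rintro ⟨⟨h1, h2⟩, h3⟩ h4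
    linarith [f0 h1, f2 h2, f5 h3, f9 h4, q1, q2, q3, q4, q5, q6, q7, q11, q14, q15]
  · rintro ⟨⟨h1, h2⟩, h3⟩ h4
    linarith [f0 h1, f3 h2, f4 h3, f7 h4, q1, q2, q3, q4, q5, q6, q7, q11, q14, q15]
  · rintro ⟨⟨h1, h2⟩, h3⟩ h4
    linarith [f0 h1, f5 h2, f6 h3, f7 h4, q1, q2, q3, q4, q5, q6, q7, q11, q14, q15]
  · rintro ⟨⟨h1, h2⟩, h3⟩ h4
    linarith [f1 h1, f2 h2, f3 h3, f6 h4, q1, q2, q3, q4, q5, q6, q7, q11, q14, q15]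
  · rintro ⟨⟨h1, h2⟩, h3⟩ h4
    linarith [f1 h1, f2 h2, f4 h3, f5 h4, q1, q2, q3, q4, q5, q6, q7, q11, q14, q15]
  · rintro ⟨⟨h1, h2⟩, h3⟩ h4
    linarith [f1 h1, f3 h2, f7 h3, f9 h4, q1, q2, q3, q4, q5, q6, q7, q11, q14, q15]
  · rintro ⟨⟨h1, h2⟩, h3⟩ h4
    linarith [f1 h1, f5 h2, f7 h3, f8 h4, q1, q2, q3, q4, q5, q6, q7, q11, q14, q15]
  · rintro ⟨⟨h1, h2⟩, h3⟩ h4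
    linarith [f2 h1, f4 h2, f7 h3, f8 h4, q1, q2, q3, q4, q5, q6, q7, q11, q14, q15]
  · rintro ⟨⟨h1, h2⟩, h3⟩ h4
    linarith [f2 h1, f6 h2, f7 h3, f9 h4, q1, q2, q3, q4, q5, q6, q7, q11, q14, q15]
  · rintro ⟨⟨h1, h2⟩, h3⟩ h4
    linarith [f3 h1, f4 h2, f5 h3, f6 h4, q1, q2, q3, q4, q5, q6, q7, q11, q14, q15]
  · rintro ⟨⟨h1, h2⟩, h3⟩ h4
    linarith [f3 h1, f5 h2, f8 h3, f9 h4, q1, q2, q3, q4, q5, q6, q7, q11, q14, q15]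
  · rintro ⟨⟨h1, h2⟩, h3⟩ h4
    linarith [f4 h1, f6 h2, f8 h3, f9 h4, q1, q2, q3, q4, q5, q6, q7, q11, q14, q15]
  · rcases candidate_or_single u hu with ⟨i, c, rfl⟩ | ⟨c, h⟩
    · exact ⟨i, c, by simpa [form_compl] using hf, rfl⟩
    · exfalso
      rcases h with rfl | rfl | rfl | rfl | rfl | rfl
      · have h := form_vec hy.symm hy.diag false false false false false false
        norm_num at h
        rw [form_compl] at hf
        linarith [H.e0, H.e1, H.e2, H.e3, H.e4, H.e5, H.e6, H.e7, H.e8, H.e9, H.e10, H.e11, H.e12,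
            H.e13, H.e14, H.e15, q1, q2, q3, q4, q5, q6, q7, q11, q14, q15]
      · have h := form_vec hy.symm hy.diag false true true false false false
        norm_num at h
        rw [form_compl] at hf
        linarith [H.e0, H.e1, H.e2, H.e3, H.e4, H.e5, H.e6, H.e7, H.e8, H.e9, H.e10, H.e11, H.e12,
            H.e13, H.e14, H.e15, q1, q2, q3, q4, q5, q6, q7, q11, q14, q15]
      · have h := form_vec hy.symm hy.diag false true false true false false
        norm_num at h
        rw [form_compl] at hf
        linarith [H.e0, H.e1, H.e2, H.e3, H.e4, H.e5, H.e6, H.e7, H.e8, H.e9, H.e10, H.e11, H.e12,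
            H.e13, H.e14, H.e15, q1, q2, q3, q4, q5, q6, q7, q11, q14, q15]
      · have h := form_vec hy.symm hy.diag false false true false true false
        norm_num at h
        rw [form_compl] at hf
        linarith [H.e0, H.e1, H.e2, H.e3, H.e4, H.e5, H.e6, H.e7, H.e8, H.e9, H.e10, H.e11, H.e12,
            H.e13, H.e14, H.e15, q1, q2, q3, q4, q5, q6, q7, q11, q14, q15]
      · have h := form_vec hy.symm hy.diag false false false true false true
        norm_num at h
        rw [form_compl] at hf
        linarith [H.e0, H.e1, H.e2, H.e3, H.e4, H.e5, H.e6, H.e7, H.e8, H.e9, H.e10, H.e11, H.e12,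
            H.e13, H.e14, H.e15, q1, q2, q3, q4, q5, q6, q7, q11, q14, q15]
      · have h := form_vec hy.symm hy.diag false false false false true true
        norm_num at h
        rw [form_compl] at hf
        linarith [H.e0, H.e1, H.e2, H.e3, H.e4, H.e5, H.e6, H.e7, H.e8, H.e9, H.e10, H.e11, H.e12,
            H.e13, H.e14, H.e15, q1, q2, q3, q4, q5, q6, q7, q11, q14, q15]

/-! ### Positivity, rank, spectrum and trace norm of diagonalised matrices -/

section Diagonalization

variable {n : Type*} [Fintype n] [DecidableEq n] {U : Matrix n n ℂ} (f : n → ℝ)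

open Matrix in
lemma posSemidef_conj_iff (hU : Uᴴ * U = 1) :
    (U * diagonal (fun j => (f j : ℂ)) * Uᴴ).PosSemidef ↔ ∀ j, 0 ≤ f j := by
  have hd : (diagonal fun j => (f j : ℂ)).PosSemidef ↔ ∀ j, 0 ≤ f j := by
    simp [posSemidef_diagonal_iff]
  rw [← hd]
  refine ⟨fun h => ?_, fun h => h.mul_mul_conjTranspose_same U⟩
  have := h.conjTranspose_mul_mul_same U
  rwa [show Uᴴ * (U * diagonal (fun j => (f j : ℂ)) * Uᴴ) * U
      = (Uᴴ * U) * diagonal (fun j => (f j : ℂ)) * (Uᴴ * U) by simp only [Matrix.mul_assoc], hU,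
    Matrix.one_mul, Matrix.mul_one] at this

open Matrix in
lemma rank_conj (hU : Uᴴ * U = 1) :
    (U * diagonal (fun j => (f j : ℂ)) * Uᴴ).rank = (Finset.univ.filter fun j => f j ≠ 0).card := by
  have h1 : IsUnit U.det := (isUnit_iff_isUnit_det U).1 (IsUnit.of_mul_eq_one _ (mul_eq_one_comm.1 hU))
  have h2 : IsUnit Uᴴ.det := (isUnit_iff_isUnit_det Uᴴ).1 (IsUnit.of_mul_eq_one _ hU)
  rw [rank_mul_eq_left_of_isUnit_det _ _ h2, rank_mul_eq_right_of_isUnit_det _ _ h1, rank_diagonal,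
    Fintype.card_subtype]
  simp

open Matrix in
lemma spectrum_conj (hU : Uᴴ * U = 1) :
    spectrum ℝ (U * diagonal (fun j => (f j : ℂ)) * Uᴴ) = Set.range f := by
  have hU' : U * Uᴴ = 1 := mul_eq_one_comm.1 hU
  have h : spectrum ℂ (U * diagonal (fun j => (f j : ℂ)) * Uᴴ) = Set.range fun j => (f j : ℂ) := by
    rw [← spectrum_diagonal]
    exact spectrum.units_conjugate (u := ⟨U, Uᴴ, hU', hU⟩)
  ext r
  rw [← spectrum.algebraMap_mem_iff ℂ, h]
  simp

lemma le_minEigenvalue_iff {A : Matrix n n ℂ} [Nonempty n] (hA : spectrum ℝ A = Set.range f)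
    (r : ℝ) : r ≤ minEigenvalue A ↔ ∀ j, r ≤ f j := by
  rw [minEigenvalue, hA, le_csInf_iff (Set.finite_range f).bddBelow (Set.range_nonempty f)]
  simp

open Matrix in
lemma traceNorm_diagonal : traceNorm (diagonal fun j => (f j : ℂ)) = ∑ j, |f j| := by
  have hs : spectrum ℝ (diagonal fun j => ((|f j| : ℝ) : ℂ)) = Set.range fun j => |f j| := by
    have := spectrum_conj (U := (1 : Matrix n n ℂ)) (fun j => |f j|) (by simp)
    simpa using this
  have ha : IsSelfAdjoint (diagonal fun j => ((|f j| : ℝ) : ℂ)) :=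
    isHermitian_diagonal_of_self_adjoint _ (by ext j; simp)
  have hm : (diagonal fun j => (f j : ℂ))ᴴ * (diagonal fun j => (f j : ℂ))
      = (diagonal fun j => ((|f j| : ℝ) : ℂ)) ^ 2 := by
    rw [diagonal_conjTranspose, diagonal_mul_diagonal, diagonal_pow]
    congr 1
    ext j
    simp only [Pi.star_apply, Complex.star_def, Complex.conj_ofReal, Pi.pow_apply]
    norm_cast
    rw [sq_abs, sq]
  -- The square root undoes the square on the spectrum of the diagonal matrix of absolute values,
  -- since that spectrum is nonnegative.
  have hc : cfc Real.sqrt ((diagonal fun j => ((|f j| : ℝ) : ℂ)) ^ 2)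
      = diagonal fun j => ((|f j| : ℝ) : ℂ) := by
    conv_rhs => rw [← cfc_id ℝ (diagonal fun j => ((|f j| : ℝ) : ℂ)) ha]
    rw [← cfc_pow_id (R := ℝ) (diagonal fun j => ((|f j| : ℝ) : ℂ)) 2 ha, ← cfc_comp _ _ _ ha]
    refine cfc_congr fun x hx => ?_
    rw [hs] at hx
    obtain ⟨j, rfl⟩ := hx
    simp [Real.sqrt_sq_eq_abs]
  rw [traceNorm, hm, hc, trace_diagonal]
  simp

end Diagonalization

/-! ### Bloch-diagonal operators in the Bell basis -/

/-- The eigenvalue of `σ_μ ⊗ σ_μ` at a Bell state. -/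
def bellSign (μ : Fin 4) (j : Q) : ℝ :=
  ![1, if j.2 = 0 then 1 else -1, if j.1 = j.2 then -1 else 1, if j.1 = 0 then 1 else -1] μ

/-- The unnormalised Bell states. -/
def bell : Matrix Q Q ℂ := Matrix.of fun i j =>
  if i.2 = i.1 + j.1 then (if j.2 = 1 ∧ i.1 = 1 then -1 else 1) else 0

open Matrix in
lemma bell_conjTranspose_mul : bellᴴ * bell = (2 : ℂ) • 1 := by
  ext ⟨a, b⟩ ⟨c, d⟩
  fin_cases a <;> fin_cases b <;> fin_cases c <;> fin_cases d <;>
    norm_num [bell, Matrix.mul_apply, Fintype.sum_prod_type, Matrix.one_apply]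

open Matrix in
lemma pauli_kronecker (μ : Fin 4) : pauli μ ⊗ₖ pauli μ
    = (1 / 2 : ℂ) • (bell * diagonal (fun j => (bellSign μ j : ℂ)) * bellᴴ) := by
  ext ⟨a, b⟩ ⟨c, d⟩
  fin_cases μ <;> fin_cases a <;> fin_cases b <;> fin_cases c <;> fin_cases d <;>
    norm_num [bell, pauli, bellSign, Matrix.mul_apply, Matrix.mul_diagonal, Fintype.sum_prod_type,
      Matrix.one_apply, show (1 : Fin 2) + 1 = 0 from rfl]

/-- The eigenvalues of the Bloch-diagonal operator with coefficients `x`. -/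
def eigenvalue (x : Fin 4 × Fin 4 → ℝ) (j : Q × Q) : ℝ :=
  1 / 4 * ∑ k, x k * (bellSign k.1 j.1 * bellSign k.2 j.2)

/-- The tensor product of two Bell bases. -/
def bellBasis : BiOp :=
  -- The reindexing pairs the first qubits of the two ququarts with each other, and likewise the
  -- second ones. The factor is `(1 / √2) ^ 2`, one normalisation for each Bell basis.
  (1 / 2 : ℂ) • (bell ⊗ₖ bell).submatrix (Equiv.prodProdProdComm _ _ _ _) id

open Matrix in
lemma bellBasis_conjTranspose_mul : bellBasisᴴ * bellBasis = 1 := by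
  rw [bellBasis, conjTranspose_smul, conjTranspose_submatrix, smul_mul_smul_comm,
    submatrix_mul_equiv, conjTranspose_kronecker, ← mul_kronecker_mul, bell_conjTranspose_mul,
    smul_kronecker, kronecker_smul, one_kronecker_one, submatrix_id_id, smul_smul, smul_smul]
  norm_num

open Matrix in
lemma g_kronecker (k : Fin 4 × Fin 4) : g k ⊗ₖ g k = bellBasis *
    diagonal (fun j => ((1 / 4 * (bellSign k.1 j.1 * bellSign k.2 j.2) : ℝ) : ℂ)) * bellBasisᴴ := by
  have h1 : g k ⊗ₖ g k = (1 / 4 : ℂ) • ((pauli k.1 ⊗ₖ pauli k.1) ⊗ₖ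
      (pauli k.2 ⊗ₖ pauli k.2)).submatrix (Equiv.prodProdProdComm _ _ _ _)
        (Equiv.prodProdProdComm _ _ _ _) := by
    ext i j
    simp only [g, kroneckerMap_apply, Matrix.smul_apply, submatrix_apply,
        Equiv.prodProdProdComm_apply,
      smul_eq_mul]
    ring
  have h2 : (diagonal fun j : Q × Q => ((1 / 4 * (bellSign k.1 j.1 * bellSign k.2 j.2) : ℝ) : ℂ))
      = (1 / 4 : ℂ) • ((diagonal fun j => (bellSign k.1 j : ℂ)) ⊗ₖ
        (diagonal fun j => (bellSign k.2 j : ℂ))) := by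
    rw [diagonal_kronecker_diagonal, ← diagonal_smul]
    congr 1; ext j; simp
  have h3 : ∀ A B C : BiOp, (A * B * C).submatrix (Equiv.prodProdProdComm (Fin 2) (Fin 2) (Fin 2)
      (Fin 2)) (Equiv.prodProdProdComm (Fin 2) (Fin 2) (Fin 2) (Fin 2)) =
      A.submatrix (Equiv.prodProdProdComm _ _ _ _) id * B *
        C.submatrix id (Equiv.prodProdProdComm _ _ _ _) := fun _ _ _ => rfl
  rw [h1, h2, pauli_kronecker, pauli_kronecker, smul_kronecker, kronecker_smul, mul_kronecker_mul,
    mul_kronecker_mul, bellBasis, conjTranspose_smul, conjTranspose_submatrix,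
    conjTranspose_kronecker, submatrix_smul, submatrix_smul, Pi.smul_apply, Pi.smul_apply,
    Pi.smul_apply, Pi.smul_apply, h3]
  simp only [Matrix.smul_mul, Matrix.mul_smul, smul_smul]
  norm_num

open Matrix in
lemma blochDiagonal_eq (x : Fin 4 × Fin 4 → ℝ) : blochDiagonal x =
    bellBasis * diagonal (fun j => (eigenvalue x j : ℂ)) * bellBasisᴴ := by
  have h : (diagonal fun j => (eigenvalue x j : ℂ)) = ∑ k, (x k : ℂ) •
      diagonal (fun j : Q × Q => ((1 / 4 * (bellSign k.1 j.1 * bellSign k.2 j.2) : ℝ) : ℂ)) := by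
    ext i j
    rw [Matrix.sum_apply]
    by_cases hij : i = j
    · subst hij
      simp only [eigenvalue, diagonal_apply_eq, Matrix.smul_apply, smul_eq_mul]
      push_cast
      rw [Finset.mul_sum]
      exact Finset.sum_congr rfl fun k _ => by ring
    · simp [diagonal_apply_ne _ hij]
  rw [h, blochDiagonal, Matrix.mul_sum, Matrix.sum_mul]
  refine Finset.sum_congr rfl fun k _ => ?_
  rw [g_kronecker, Matrix.mul_smul, Matrix.smul_mul]

lemma posSemidef_blochDiagonal (x : Fin 4 × Fin 4 → ℝ) :
    (blochDiagonal x).PosSemidef ↔ ∀ j, 0 ≤ eigenvalue x j := by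
  rw [blochDiagonal_eq, posSemidef_conj_iff _ bellBasis_conjTranspose_mul]

lemma rank_blochDiagonal (x : Fin 4 × Fin 4 → ℝ) :
    (blochDiagonal x).rank = (Finset.univ.filter fun j => eigenvalue x j ≠ 0).card := by
  rw [blochDiagonal_eq, rank_conj _ bellBasis_conjTranspose_mul]

lemma le_minEigenvalue_blochDiagonal (x : Fin 4 × Fin 4 → ℝ) (r : ℝ) :
    r ≤ minEigenvalue (blochDiagonal x) ↔ ∀ j, r ≤ eigenvalue x j := by
  refine le_minEigenvalue_iff _ ?_ r
  rw [blochDiagonal_eq, spectrum_conj _ bellBasis_conjTranspose_mul]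

/-- The sign of the transpose of a Pauli matrix. -/
def transposeSign (μ : Fin 4) : ℝ := if μ = 2 then -1 else 1

lemma pauli_transpose (μ : Fin 4) (i j : Fin 2) : pauli μ j i = transposeSign μ * pauli μ i j := by
  fin_cases μ <;> fin_cases i <;> fin_cases j <;> simp [pauli, transposeSign]

/-- The coefficients of the partial transpose. -/
def transposedCoeff (x : Fin 4 × Fin 4 → ℝ) (k : Fin 4 × Fin 4) : ℝ :=
  transposeSign k.1 * transposeSign k.2 * x k

/-- Among the matrices in `pauli` only `σ_2` changes sign under transposition, so partial
transposition stays within the Bloch-diagonal operators. -/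
lemma partialTranspose_blochDiagonal (x : Fin 4 × Fin 4 → ℝ) :
    partialTranspose (blochDiagonal x) = blochDiagonal (transposedCoeff x) := by
  ext i j
  simp only [partialTranspose, blochDiagonal, Matrix.of_apply, Matrix.sum_apply, Matrix.smul_apply,
    Matrix.kroneckerMap_apply, transposedCoeff, g, smul_eq_mul]
  refine Finset.sum_congr rfl fun k _ => ?_
  rw [pauli_transpose k.1 i.2.1, pauli_transpose k.2 i.2.2]
  push_cast
  ring

lemma trace_pauli_mul (μ ν : Fin 4) : (pauli μ * pauli ν).trace = if μ = ν then 2 else 0 := by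
  fin_cases μ <;> fin_cases ν <;>
    simp [pauli, Matrix.trace, Fin.sum_univ_two] <;> norm_num

lemma trace_g_mul (k l : Fin 4 × Fin 4) : (g k * g l).trace = if k = l then 1 else 0 := by
  rw [g, g, smul_mul_smul_comm, ← Matrix.mul_kronecker_mul, Matrix.trace_smul,
    Matrix.trace_kronecker, trace_pauli_mul, trace_pauli_mul]
  by_cases h1 : k.1 = l.1 <;> by_cases h2 : k.2 = l.2 <;> simp [h1, h2, Prod.ext_iff]
  norm_num

lemma realignment_blochDiagonal (x : Fin 4 × Fin 4 → ℝ) :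
    realignment (blochDiagonal x) = Matrix.diagonal fun k => (x k : ℂ) := by
  ext k l
  simp only [realignment, Matrix.of_apply, blochDiagonal, Matrix.sum_mul, Matrix.smul_mul,
    Matrix.trace_sum, Matrix.trace_smul, ← Matrix.mul_kronecker_mul, Matrix.trace_kronecker,
    trace_g_mul]
  by_cases h : k = l
  · subst h; simp
  · rw [Matrix.diagonal_apply_ne _ h]
    refine Finset.sum_eq_zero fun m _ => ?_
    by_cases hm : m = k
    · subst hm; simp [h]
    · simp [hm]

lemma traceNorm_realignment (x : Fin 4 × Fin 4 → ℝ) :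
    traceNorm (realignment (blochDiagonal x)) = ∑ k, |x k| := by
  rw [realignment_blochDiagonal, traceNorm_diagonal]

lemma trace_g (k : Fin 4 × Fin 4) : (g k).trace = if k = (0, 0) then 2 else 0 := by
  have h : g k = (2 : ℂ) • (g k * g (0, 0)) := by
    have : g (0, 0) = (1 / 2 : ℂ) • 1 := by simp [g, pauli]
    rw [this]; simp
  rw [h, Matrix.trace_smul, trace_g_mul]
  split_ifs <;> simp

lemma trace_blochDiagonal (x : Fin 4 × Fin 4 → ℝ) : (blochDiagonal x).trace = 4 * x (0, 0) := by
  rw [blochDiagonal, Matrix.trace_sum, Finset.sum_eq_single (0, 0)]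
  · rw [Matrix.trace_smul, Matrix.trace_kronecker, trace_g]; simp; ring
  · intro k _ hk
    rw [Matrix.trace_smul, Matrix.trace_kronecker, trace_g]; simp [hk]
  · simp

/-! ### The realignment criterion for Bloch-diagonal operators -/

lemma g_isHermitian (k : Fin 4 × Fin 4) : (g k).conjTranspose = g k := by
  have h : ∀ μ, (pauli μ).conjTranspose = pauli μ := by
    intro μ
    ext i j
    fin_cases μ <;> fin_cases i <;> fin_cases j <;> simp [pauli]
  rw [g, Matrix.conjTranspose_smul, Matrix.conjTranspose_kronecker, h, h]
  simp

/-- The Bloch coefficients of an operator. -/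
def blochCoeff (a : Op) (k : Fin 4 × Fin 4) : ℝ := (a * g k).trace.re

lemma trace_mul_g {a : Op} (ha : a.IsHermitian) (k : Fin 4 × Fin 4) :
    (a * g k).trace = blochCoeff a k := by
  have h : star (a * g k).trace = (a * g k).trace := by
    rw [← Matrix.trace_conjTranspose, Matrix.conjTranspose_mul, g_isHermitian, ha.eq,
      Matrix.trace_mul_comm]
  exact (Complex.conj_eq_iff_re.1 h).symm

open Matrix in
lemma trace_mul_self_le {a : Op} (ha : IsState a) : (a * a).trace.re ≤ 1 := by
  have hh := ha.1.isHermitian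
  have h0 := ha.1.eigenvalues_nonneg
  have h1 : ∑ i, hh.eigenvalues i = 1 := by
    have := hh.trace_eq_sum_eigenvalues
    rw [ha.2] at this
    apply Complex.ofReal_injective
    rw [Complex.ofReal_sum]
    exact this.symm
  have hle : ∀ i, hh.eigenvalues i ≤ 1 := fun i => by
    rw [← h1]; exact Finset.single_le_sum (fun j _ => h0 j) (Finset.mem_univ i)
  have h2 : (a * a).trace = ∑ i, ((hh.eigenvalues i ^ 2 : ℝ) : ℂ) := by
    conv_lhs => rw [hh.spectral_theorem]
    rw [← map_mul, diagonal_mul_diagonal, Unitary.conjStarAlgAut_apply, Matrix.trace_mul_cycle,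
      Unitary.coe_star_mul_self, Matrix.one_mul, trace_diagonal]
    simp [sq]
  rw [h2, ← Complex.ofReal_sum, Complex.ofReal_re, ← h1]
  exact Finset.sum_le_sum fun i _ => by nlinarith [h0 i, hle i]

/-- Bessel's inequality for the Bloch coefficients. -/
lemma sum_blochCoeff_sq_le {a : Op} (ha : IsState a) : ∑ k, blochCoeff a k ^ 2 ≤ 1 := by
  have hh := ha.1.isHermitian
  refine le_trans ?_ (trace_mul_self_le ha)
  set s : Op := ∑ k, (blochCoeff a k : ℂ) • g k with hs
  have hsh : s.conjTranspose = s := by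
    simp [hs, Matrix.conjTranspose_sum, Matrix.conjTranspose_smul, g_isHermitian]
  have has : (a * s).trace = ((∑ k, blochCoeff a k ^ 2 : ℝ) : ℂ) := by
    rw [hs, Matrix.mul_sum, Matrix.trace_sum]
    push_cast
    refine Finset.sum_congr rfl fun k _ => ?_
    rw [Matrix.mul_smul, Matrix.trace_smul, trace_mul_g hh, smul_eq_mul, sq]
  have hss : (s * s).trace = ((∑ k, blochCoeff a k ^ 2 : ℝ) : ℂ) := by
    have : ∀ k, (g k * s).trace = blochCoeff a k := by
      intro k
      rw [hs, Matrix.mul_sum, Matrix.trace_sum]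
      simp [Matrix.trace_smul, trace_g_mul]
    conv_lhs => rw [hs]
    rw [Matrix.sum_mul, Matrix.trace_sum]
    push_cast
    refine Finset.sum_congr rfl fun k _ => ?_
    rw [Matrix.smul_mul, Matrix.trace_smul, this, smul_eq_mul, sq]
  -- The squared Hilbert-Schmidt distance from `a` to its expansion `s` is nonnegative, which is
  -- Bessel's inequality.
  have h := (Matrix.posSemidef_conjTranspose_mul_self (a - s)).trace_nonneg
  rw [Matrix.conjTranspose_sub, hsh, hh.eq, Matrix.sub_mul, Matrix.mul_sub, Matrix.mul_sub,
    Matrix.trace_sub, Matrix.trace_sub, Matrix.trace_sub, Matrix.trace_mul_comm s a, has, hss] at h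
  have := (Complex.le_def.1 h).1
  simp only [Complex.sub_re, Complex.ofReal_re, Complex.zero_re] at this
  linarith

/-- The computable cross norm criterion, for Bloch-diagonal operators. -/
lemma sum_abs_le_of_isSeparable {x : Fin 4 × Fin 4 → ℝ} (h : IsSeparable (blochDiagonal x)) :
    ∑ k, |x k| ≤ 1 := by
  -- A linear witness whose value at the given operator is `∑ |x_k|`. On product states it is at
  -- most 1, by `2 |a b| ≤ a² + b²` and Bessel's inequality, hence on their convex hull too.
  let F : BiOp → ℝ := fun ρ => ∑ k, (SignType.sign (x k) : ℝ) * (ρ * (g k ⊗ₖ g k)).trace.re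
  have hF : ∀ (r s : ℝ) (ρ τ : BiOp), F (r • ρ + s • τ) = r * F ρ + s * F τ := by
    intro r s ρ τ
    simp only [F, Matrix.add_mul, Matrix.smul_mul, Matrix.trace_add, Matrix.trace_smul,
      Complex.add_re, Complex.smul_re, smul_eq_mul, Finset.mul_sum, ← Finset.sum_add_distrib]
    exact Finset.sum_congr rfl fun k _ => by ring
  have hconv : Convex ℝ {ρ : BiOp | F ρ ≤ 1} := by
    intro ρ hρ τ hτ r s hr hs hrs
    simp only [Set.mem_ofPred_eq] at *
    rw [hF]
    nlinarith [mul_le_mul_of_nonneg_left hρ hr, mul_le_mul_of_nonneg_left hτ hs]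
  have hsub : {τ : BiOp | ∃ a b : Op, IsState a ∧ IsState b ∧ τ = a ⊗ₖ b} ⊆ {ρ | F ρ ≤ 1} := by
    rintro _ ⟨a, b, ha, hb, rfl⟩
    have h1 : F (a ⊗ₖ b) = ∑ k, (SignType.sign (x k) : ℝ) * (blochCoeff a k * blochCoeff b k) := by
      refine Finset.sum_congr rfl fun k _ => ?_
      rw [← Matrix.mul_kronecker_mul, Matrix.trace_kronecker, trace_mul_g ha.1.isHermitian,
        trace_mul_g hb.1.isHermitian, ← Complex.ofReal_mul, Complex.ofReal_re]
    have h2 : F (a ⊗ₖ b) ≤ ∑ k, (blochCoeff a k ^ 2 + blochCoeff b k ^ 2) / 2 := by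
      rw [h1]
      refine Finset.sum_le_sum fun k _ => ?_
      rcases lt_trichotomy (x k) 0 with hk | hk | hk
      · rw [sign_neg hk]; simp; nlinarith [sq_nonneg (blochCoeff a k + blochCoeff b k)]
      · rw [hk]; simp; positivity
      · rw [sign_pos hk]; simp; nlinarith [sq_nonneg (blochCoeff a k - blochCoeff b k)]
    rw [← Finset.sum_div, Finset.sum_add_distrib] at h2
    have := sum_blochCoeff_sq_le ha
    have := sum_blochCoeff_sq_le hb
    show F (a ⊗ₖ b) ≤ 1
    linarith
  have h1 : F (blochDiagonal x) ≤ 1 := convexHull_min hsub hconv h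
  refine le_trans (le_of_eq ?_) h1
  refine Finset.sum_congr rfl fun k _ => ?_
  have : (blochDiagonal x * (g k ⊗ₖ g k)).trace = (x k : ℂ) := by
    have := congrFun (congrFun (realignment_blochDiagonal x) k) k
    simpa [realignment] using this
  rw [this, Complex.ofReal_re, sign_mul_self]

/-! ### Zeros of a probability distribution on a 4 × 4 grid -/

/-- Two rows of a `4 × 4` pattern, encoded in binary, share at least two marked columns. -/
def sharesTwo (a b : ℕ) : Bool := !Nat.beq (Nat.land (Nat.land a b) (Nat.sub (Nat.land a b) 1)) 0

/-- The number of binary digits of a number below `16`. -/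
def popCount (a : ℕ) : ℕ :=
  Nat.add (Nat.add (a % 2) (a / 2 % 2)) (Nat.add (a / 4 % 2) (a / 8 % 2))

/-- Intersecting `m` with `m - 1` deletes the lowest binary digit 1 of `m`, so a nonzero result
means two common columns; a permutation moves 0 and 1 to them. -/
lemma sharesTwo_iff : ∀ a < 16, ∀ b < 16, sharesTwo a b = true →
    ∃ σ : Equiv.Perm (Fin 4), (a.testBit (σ 0) && a.testBit (σ 1) &&
      b.testBit (σ 0) && b.testBit (σ 1)) = true := by
  decide +kernel

/-- The nested alternatives prune the search over four rows: further rows are tried only while no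
two rows already form a rectangle. -/
lemma shares_or_transversal : ∀ a b : Fin 16, sharesTwo a b = true ∨ ∀ c : Fin 16,
    (sharesTwo a c || sharesTwo b c) = true ∨ ∀ d : Fin 16,
    (sharesTwo a d || sharesTwo b d || sharesTwo c d ||
      Nat.blt (popCount a + popCount b + popCount c + popCount d) 8) = true ∨
    ∃ σ : Equiv.Perm (Fin 4), (Nat.testBit a (σ 0) && Nat.testBit b (σ 1) &&
      Nat.testBit c (σ 2) && Nat.testBit d (σ 3)) = true := by
  decide +kernel

/-- Eight marked cells of a `4 × 4` grid contain the corners of a rectangle or a transversal. -/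
lemma rectangle_or_transversal (z : Fin 4 → Fin 4 → Bool)
    (hz : 8 ≤ ∑ i, ∑ j, (z i j).toNat) :
    (∃ σ τ : Equiv.Perm (Fin 4), ∀ i j : Fin 4, i < 2 → j < 2 → z (σ i) (τ j) = true) ∨
    ∃ σ : Equiv.Perm (Fin 4), ∀ i, z i (σ i) = true := by
  set r : Fin 4 → ℕ := fun i => Nat.ofBits (z i) with hr
  have hlt : ∀ i, r i < 16 := fun i => Nat.ofBits_lt_two_pow _
  have hb : ∀ i j : Fin 4, (r i).testBit j = z i j := fun i j => Nat.testBit_ofBits_lt _ _ j.2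
  have hp : ∀ i, popCount (r i) = ∑ j, (z i j).toNat := by
    have key : ∀ a b c d : Bool, popCount (Nat.ofBits ![a, b, c, d]) =
        a.toNat + b.toNat + c.toNat + d.toNat := by decide +kernel
    intro i
    have : z i = ![z i 0, z i 1, z i 2, z i 3] := by funext k; fin_cases k <;> rfl
    rw [Fin.sum_univ_four, ← key, ← this]
  have hrect : ∀ i j, i ≠ j → sharesTwo (r i) (r j) = true →
      ∃ σ τ : Equiv.Perm (Fin 4), ∀ i j : Fin 4, i < 2 → j < 2 → z (σ i) (τ j) = true := by
    intro i j hij h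
    obtain ⟨τ, hτ⟩ := sharesTwo_iff _ (hlt i) _ (hlt j) h
    obtain ⟨σ, h0, h1⟩ : ∃ σ : Equiv.Perm (Fin 4), σ 0 = i ∧ σ 1 = j := by
      have : ∀ i j : Fin 4, i ≠ j → ∃ σ : Equiv.Perm (Fin 4), σ 0 = i ∧ σ 1 = j := by decide +kernel
      exact this i j hij
    simp only [hb, Bool.and_eq_true] at hτ
    refine ⟨σ, τ, fun a b ha hb => ?_⟩
    have ha' : a = 0 ∨ a = 1 := by omega
    have hb' : b = 0 ∨ b = 1 := by omega
    rcases ha' with rfl | rfl <;> rcases hb' with rfl | rfl <;> simp [h0, h1, hτ]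
  rw [Fin.sum_univ_four, ← hp, ← hp, ← hp, ← hp] at hz
  rcases shares_or_transversal ⟨_, hlt 0⟩ ⟨_, hlt 1⟩ with h | h
  · exact Or.inl (hrect 0 1 (by decide) h)
  rcases h ⟨_, hlt 2⟩ with h | h
  · rw [Bool.or_eq_true] at h
    rcases h with h | h
    exacts [Or.inl (hrect 0 2 (by decide) h), Or.inl (hrect 1 2 (by decide) h)]
  rcases h ⟨_, hlt 3⟩ with h | ⟨σ, h⟩
  · simp only [Bool.or_eq_true, Nat.blt_eq] at h
    rcases h with ((h | h) | h) | h
    exacts [Or.inl (hrect 0 3 (by decide) h), Or.inl (hrect 1 3 (by decide) h),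
      Or.inl (hrect 2 3 (by decide) h), absurd hz (by omega)]
  · simp only [hb, Bool.and_eq_true] at h
    refine Or.inr ⟨σ, fun i => ?_⟩
    fin_cases i <;> simp [h]

/-- A probability distribution on the `4 × 4` grid all of whose crosses have weight less than one
half has at most seven zeros. -/
lemma sum_zeros_lt {p : Fin 4 → Fin 4 → ℝ} (h1 : ∑ i, ∑ j, p i j = 1)
    (hc : ∀ i j, ∑ l, p i l + ∑ l, p l j - 2 * p i j < 1 / 2) :
    ∑ i, ∑ j, (decide (p i j = 0)).toNat < 8 := by
  by_contra! h
  rcases rectangle_or_transversal _ h with ⟨σ, τ, hz⟩ | ⟨σ, hz⟩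
  · have hz' : ∀ i j : Fin 4, i < 2 → j < 2 → p (σ i) (τ j) = 0 := fun i j hi hj => by
      simpa using hz i j hi hj
    have h00 := hz' 0 0 (by decide) (by decide)
    have h01 := hz' 0 1 (by decide) (by decide)
    have h10 := hz' 1 0 (by decide) (by decide)
    have h11 := hz' 1 1 (by decide) (by decide)
    have hs : ∑ i, ∑ j, p (σ i) (τ j) = 1 := by
      rw [← h1, ← Equiv.sum_comp σ fun i => ∑ j, p i j]
      exact Finset.sum_congr rfl fun i _ => Equiv.sum_comp τ _
    have hc' : ∀ i j, ∑ l, p (σ i) (τ l) + ∑ l, p (σ l) (τ j) - 2 * p (σ i) (τ j) < 1 / 2 :=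
      fun i j => by
        rw [Equiv.sum_comp τ, Equiv.sum_comp σ fun l => p l (τ j)]; exact hc _ _
    -- The crosses at the four cells of the block opposite to the zero rectangle cover every cell
    -- outside the rectangle exactly twice, so their total weight is 2, not less.
    have c22 := hc' 2 2
    have c23 := hc' 2 3
    have c32 := hc' 3 2
    have c33 := hc' 3 3
    simp only [Fin.sum_univ_four] at hs c22 c23 c32 c33
    linarith
  · have hz' : ∀ i, p i (σ i) = 0 := fun i => by simpa using hz i
    -- The crosses along a transversal use every row and every column once; as `p` vanishes on the
    -- transversal, their total weight is 2.
    have h2 : ∑ i, (∑ l, p i l + ∑ l, p l (σ i) - 2 * p i (σ i)) < ∑ _i : Fin 4, (1 / 2 : ℝ) :=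
      Finset.sum_lt_sum_of_nonempty ⟨0, Finset.mem_univ _⟩ fun i _ => hc i (σ i)
    simp only [hz', Finset.sum_add_distrib, mul_zero, sub_zero] at h2
    rw [Equiv.sum_comp σ fun j => ∑ l, p l j, Finset.sum_comm (f := fun i j => p j i), h1] at h2
    norm_num at h2

/-! ### From Bloch coefficients to cut forms -/

/-- The coefficients `x_k`, `k ≠ 00`, as weights of the edges of the complete graph on six
vertices; edges without common vertex correspond to commuting Pauli matrices. -/
def edgeWeight (x : Fin 4 × Fin 4 → ℝ) : Fin 6 → Fin 6 → ℝ :=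
  -- Minus signs stand exactly where partial transposition flips the coefficient. The factor 4
  -- scales `x (0, 0) = 1 / 4` to 1. Vertices 0, 1, 2 carry the Pauli matrices of the second qubit,
  -- vertices 3, 4, 5 those of the first.
  ![![0, 4 * x (0, 1), -4 * x (0, 2), 4 * x (1, 3), -4 * x (2, 3), 4 * x (3, 3)],
    ![4 * x (0, 1), 0, 4 * x (0, 3), -4 * x (1, 2), 4 * x (2, 2), -4 * x (3, 2)],
    ![-4 * x (0, 2), 4 * x (0, 3), 0, 4 * x (1, 1), -4 * x (2, 1), 4 * x (3, 1)],
    ![4 * x (1, 3), -4 * x (1, 2), 4 * x (1, 1), 0, 4 * x (3, 0), -4 * x (2, 0)],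
    ![-4 * x (2, 3), 4 * x (2, 2), -4 * x (2, 1), 4 * x (3, 0), 0, 4 * x (1, 0)],
    ![4 * x (3, 3), -4 * x (3, 2), 4 * x (3, 1), -4 * x (2, 0), 4 * x (1, 0), 0]]

lemma edgeWeight_symm (x : Fin 4 × Fin 4 → ℝ) (a b : Fin 6) :
    edgeWeight x a b = edgeWeight x b a := by
  fin_cases a <;> fin_cases b <;> rfl

lemma edgeWeight_diag (x : Fin 4 × Fin 4 → ℝ) (a : Fin 6) : edgeWeight x a a = 0 := by
  fin_cases a <;> rfl

/-- The even subset of the six vertices belonging to a pair of Bell states. -/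
def evenCut (j : Q × Q) : Fin 6 → Bool :=
  ![j.2.1 == 1, (j.2.1 == 1) ^^ (j.2.2 == 1), j.2.2 == 1, j.1.2 == 1,
    (j.1.1 == 1) ^^ (j.1.2 == 1), j.1.1 == 1]

/-- The odd subset of the six vertices belonging to a pair of Bell states. -/
def oddCut (j : Q × Q) : Fin 6 → Bool :=
  ![!(j.2.1 == 1), (j.2.1 == 1) ^^ (j.2.2 == 1), !(j.2.2 == 1), j.1.2 == 1,
    !((j.1.1 == 1) ^^ (j.1.2 == 1)), j.1.1 == 1]

lemma form_edgeWeight (x : Fin 4 × Fin 4 → ℝ) (u0 u1 u2 u3 u4 u5 : Bool) :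
    form (edgeWeight x) ![u0, u1, u2, u3, u4, u5] = 8 * (
      sg (u0 ^^ u1) * x (0, 1) - sg (u0 ^^ u2) * x (0, 2) + sg (u0 ^^ u3) * x (1, 3) -
      sg (u0 ^^ u4) * x (2, 3) + sg (u0 ^^ u5) * x (3, 3) + sg (u1 ^^ u2) * x (0, 3) -
      sg (u1 ^^ u3) * x (1, 2) + sg (u1 ^^ u4) * x (2, 2) - sg (u1 ^^ u5) * x (3, 2) +
      sg (u2 ^^ u3) * x (1, 1) - sg (u2 ^^ u4) * x (2, 1) + sg (u2 ^^ u5) * x (3, 1) +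
      sg (u3 ^^ u4) * x (3, 0) - sg (u3 ^^ u5) * x (2, 0) + sg (u4 ^^ u5) * x (1, 0)) := by
  rw [form_vec (edgeWeight_symm x) (edgeWeight_diag x)]
  simp only [show edgeWeight x 0 1 = 4 * x (0, 1) from rfl,
    show edgeWeight x 0 2 = -4 * x (0, 2) from rfl, show edgeWeight x 0 3 = 4 * x (1, 3) from rfl,
    show edgeWeight x 0 4 = -4 * x (2, 3) from rfl, show edgeWeight x 0 5 = 4 * x (3, 3) from rfl,
    show edgeWeight x 1 2 = 4 * x (0, 3) from rfl, show edgeWeight x 1 3 = -4 * x (1, 2) from rfl,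
    show edgeWeight x 1 4 = 4 * x (2, 2) from rfl, show edgeWeight x 1 5 = -4 * x (3, 2) from rfl,
    show edgeWeight x 2 3 = 4 * x (1, 1) from rfl, show edgeWeight x 2 4 = -4 * x (2, 1) from rfl,
    show edgeWeight x 2 5 = 4 * x (3, 1) from rfl, show edgeWeight x 3 4 = 4 * x (3, 0) from rfl,
    show edgeWeight x 3 5 = -4 * x (2, 0) from rfl, show edgeWeight x 4 5 = 4 * x (1, 0) from rfl]
  ring

lemma eigenvalue_eq (x : Fin 4 × Fin 4 → ℝ) (j : Q × Q) : eigenvalue x j = 1 / 4 *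
    (x (0, 0) + bellSign 1 j.2 * x (0, 1) + bellSign 2 j.2 * x (0, 2) + bellSign 3 j.2 * x (0, 3) +
    bellSign 1 j.1 * (x (1, 0) + bellSign 1 j.2 * x (1, 1) + bellSign 2 j.2 * x (1, 2) +
      bellSign 3 j.2 * x (1, 3)) +
    bellSign 2 j.1 * (x (2, 0) + bellSign 1 j.2 * x (2, 1) + bellSign 2 j.2 * x (2, 2) +
      bellSign 3 j.2 * x (2, 3)) +
    bellSign 3 j.1 * (x (3, 0) + bellSign 1 j.2 * x (3, 1) + bellSign 2 j.2 * x (3, 2) +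
      bellSign 3 j.2 * x (3, 3))) := by
  have h0 : ∀ i, bellSign 0 i = 1 := fun _ => rfl
  simp only [eigenvalue, Fintype.sum_prod_type, Fin.sum_univ_four, h0]
  ring

lemma bellSign_one (i : Q) : bellSign 1 i = if i.2 = 0 then 1 else -1 := rfl

lemma bellSign_two (i : Q) : bellSign 2 i = if i.1 = i.2 then -1 else 1 := rfl

lemma bellSign_three (i : Q) : bellSign 3 i = if i.1 = 0 then 1 else -1 := rfl

lemma eigenvalue_transposedCoeff (x : Fin 4 × Fin 4 → ℝ) (j : Q × Q) :
    eigenvalue (transposedCoeff x) j = 1 / 4 *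
    (x (0, 0) + bellSign 1 j.2 * x (0, 1) - bellSign 2 j.2 * x (0, 2) + bellSign 3 j.2 * x (0, 3) +
    bellSign 1 j.1 * (x (1, 0) + bellSign 1 j.2 * x (1, 1) - bellSign 2 j.2 * x (1, 2) +
      bellSign 3 j.2 * x (1, 3)) -
    bellSign 2 j.1 * (x (2, 0) + bellSign 1 j.2 * x (2, 1) - bellSign 2 j.2 * x (2, 2) +
      bellSign 3 j.2 * x (2, 3)) +
    bellSign 3 j.1 * (x (3, 0) + bellSign 1 j.2 * x (3, 1) - bellSign 2 j.2 * x (3, 2) +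
      bellSign 3 j.2 * x (3, 3))) := by
  have h0 : transposeSign 0 = 1 := if_neg (by decide)
  have h1 : transposeSign 1 = 1 := if_neg (by decide)
  have h2 : transposeSign 2 = -1 := if_pos rfl
  have h3 : transposeSign 3 = 1 := if_neg (by decide)
  rw [eigenvalue_eq]
  simp only [transposedCoeff, h0, h1, h2, h3]
  ring

lemma form_evenCut {x : Fin 4 × Fin 4 → ℝ} (h0 : x (0, 0) = 1 / 4) (j : Q × Q) :
    form (edgeWeight x) (evenCut j) = 32 * eigenvalue x j - 2 := by
  obtain ⟨⟨a, b⟩, c, d⟩ := j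
  rw [evenCut, form_edgeWeight, eigenvalue_eq, h0]
  fin_cases a <;> fin_cases b <;> fin_cases c <;> fin_cases d <;>
    norm_num [bellSign_one, bellSign_two, bellSign_three,
        show ((0 : Fin 2) == 1) = false from rfl] <;>
    ring

lemma form_oddCut {x : Fin 4 × Fin 4 → ℝ} (h0 : x (0, 0) = 1 / 4) (j : Q × Q) :
    form (edgeWeight x) (oddCut j) = 2 - 32 * eigenvalue (transposedCoeff x) j := by
  obtain ⟨⟨a, b⟩, c, d⟩ := j
  rw [oddCut, form_edgeWeight, eigenvalue_transposedCoeff, h0]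
  fin_cases a <;> fin_cases b <;> fin_cases c <;> fin_cases d <;>
    norm_num [bellSign_one, bellSign_two, bellSign_three,
        show ((0 : Fin 2) == 1) = false from rfl] <;>
    ring

lemma exists_evenCut (u : Fin 6 → Bool) (hu : parity u = false) :
    ∃ j c, u = fun a => evenCut j a ^^ c := by
  have key : ∀ u0 u1 u2 u3 u4 u5 : Bool, parity ![u0, u1, u2, u3, u4, u5] = false →
      ∃ j c, ![u0, u1, u2, u3, u4, u5] = fun a => evenCut j a ^^ c := by
    decide +kernel
  revert hu
  rw [show u = ![u 0, u 1, u 2, u 3, u 4, u 5] by funext k; fin_cases k <;> rfl]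
  exact key _ _ _ _ _ _

lemma exists_oddCut (u : Fin 6 → Bool) (hu : parity u = true) :
    ∃ j c, u = fun a => oddCut j a ^^ c := by
  have key : ∀ u0 u1 u2 u3 u4 u5 : Bool, parity ![u0, u1, u2, u3, u4, u5] = true →
      ∃ j c, ![u0, u1, u2, u3, u4, u5] = fun a => oddCut j a ^^ c := by
    decide +kernel
  revert hu
  rw [show u = ![u 0, u 1, u 2, u 3, u 4, u 5] by funext k; fin_cases k <;> rfl]
  exact key _ _ _ _ _ _

lemma parity_evenCut : ∀ j c, parity (fun a => evenCut j a ^^ c) = false := by decide +kernel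

lemma evenCut_injective : ∀ p q : (Q × Q) × Bool,
    (fun a => evenCut p.1 a ^^ p.2) = (fun a => evenCut q.1 a ^^ q.2) → p = q := by
  decide +kernel

lemma cutBounds_edgeWeight {x : Fin 4 × Fin 4 → ℝ} {t : ℝ} (h0 : x (0, 0) = 1 / 4)
    (h1 : ∀ j, 0 ≤ eigenvalue x j) (h2 : ∀ j, (1 - t) / 16 ≤ eigenvalue (transposedCoeff x) j) :
    CutBounds t (edgeWeight x) where
  symm := edgeWeight_symm x
  diag := edgeWeight_diag x
  even u hu := by
    obtain ⟨j, c, rfl⟩ := exists_evenCut u hu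
    rw [form_compl, form_evenCut h0]
    linarith [h1 j]
  odd u hu := by
    obtain ⟨j, c, rfl⟩ := exists_oddCut u hu
    rw [form_compl, form_oddCut h0]
    linarith [h2 j]

/-- A zero eigenvalue makes an even subset and its complement tight, and distinct eigenvalue indices
give distinct cuts. -/
lemma two_mul_card_le_tightCount {x : Fin 4 × Fin 4 → ℝ} (h0 : x (0, 0) = 1 / 4) :
    2 * (Finset.univ.filter fun j => eigenvalue x j = 0).card ≤ tightCount (edgeWeight x) := by
  have : ((Finset.univ.filter fun j => eigenvalue x j = 0) ×ˢ (Finset.univ : Finset Bool)).card ≤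
      tightCount (edgeWeight x) := by
    refine Finset.card_le_card_of_injOn (fun p a => evenCut p.1 a ^^ p.2) (fun p hp => ?_)
      (fun p _ q _ h => evenCut_injective p q h)
    have hp' : eigenvalue x p.1 = 0 := by simpa using hp
    simp [parity_evenCut, form_compl, form_evenCut h0, hp']
  rw [Finset.card_product] at this
  simp at this
  omega

lemma sum_abs_eq (x : Fin 4 × Fin 4 → ℝ) : ∑ k, |x k| =
    |x (0, 0)| + |x (0, 1)| + |x (0, 2)| + |x (0, 3)| + |x (1, 0)| + |x (1, 1)| + |x (1, 2)| +
    |x (1, 3)| + |x (2, 0)| + |x (2, 1)| + |x (2, 2)| + |x (2, 3)| + |x (3, 0)| + |x (3, 1)| +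
    |x (3, 2)| + |x (3, 3)| := by
  simp only [Fintype.sum_prod_type, Fin.sum_univ_four]
  ring

lemma sum_abs_edgeWeight {x : Fin 4 × Fin 4 → ℝ} (h0 : x (0, 0) = 1 / 4) :
    ∑ a, ∑ b, |edgeWeight x a b| = 8 * ∑ k, |x k| - 2 := by
  have h4 : ∀ z : ℝ, |4 * z| = 4 * |z| := fun z => by rw [abs_mul]; norm_num
  have h4' : ∀ z : ℝ, |-4 * z| = 4 * |z| := fun z => by rw [abs_mul]; norm_num
  rw [sum_abs_eq, h0]
  simp only [Fin.sum_univ_six, edgeWeight, Matrix.cons_val, h4, h4']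
  norm_num
  ring

/-! ### Crosses of eigenvalues and the rank bound nine -/

lemma sum_bellSign : ∑ l, bellSign 1 l = 0 ∧ ∑ l, bellSign 2 l = 0 ∧ ∑ l, bellSign 3 l = 0 := by
  simp [Fintype.sum_prod_type, bellSign_one, bellSign_two, bellSign_three]

lemma sum_eigenvalue_right (x : Fin 4 × Fin 4 → ℝ) (i : Q) : ∑ l, eigenvalue x (i, l) =
    x (0, 0) + bellSign 1 i * x (1, 0) + bellSign 2 i * x (2, 0) + bellSign 3 i * x (3, 0) := by
  obtain ⟨h1, h2, h3⟩ := sum_bellSign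
  simp only [Fintype.sum_prod_type, Fin.sum_univ_two, eigenvalue_eq] at *
  linear_combination (x (0, 1) + bellSign 1 i * x (1, 1) + bellSign 2 i * x (2, 1) +
      bellSign 3 i * x (3, 1)) / 4 * h1 + (x (0, 2) + bellSign 1 i * x (1, 2) +
      bellSign 2 i * x (2, 2) + bellSign 3 i * x (3, 2)) / 4 * h2 + (x (0, 3) +
      bellSign 1 i * x (1, 3) + bellSign 2 i * x (2, 3) + bellSign 3 i * x (3, 3)) / 4 * h3

lemma sum_eigenvalue_left (x : Fin 4 × Fin 4 → ℝ) (j : Q) : ∑ l, eigenvalue x (l, j) =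
    x (0, 0) + bellSign 1 j * x (0, 1) + bellSign 2 j * x (0, 2) + bellSign 3 j * x (0, 3) := by
  obtain ⟨h1, h2, h3⟩ := sum_bellSign
  simp only [Fintype.sum_prod_type, Fin.sum_univ_two, eigenvalue_eq] at *
  linear_combination (x (1, 0) + bellSign 1 j * x (1, 1) + bellSign 2 j * x (1, 2) +
      bellSign 3 j * x (1, 3)) / 4 * h1 + (x (2, 0) + bellSign 1 j * x (2, 1) +
      bellSign 2 j * x (2, 2) + bellSign 3 j * x (2, 3)) / 4 * h2 + (x (3, 0) +
      bellSign 1 j * x (3, 1) + bellSign 2 j * x (3, 2) + bellSign 3 j * x (3, 3)) / 4 * h3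

lemma bellSign_flip (i : Q) : bellSign 1 (i.1 + 1, i.2 + 1) = -bellSign 1 i ∧
    bellSign 2 (i.1 + 1, i.2 + 1) = bellSign 2 i ∧
    bellSign 3 (i.1 + 1, i.2 + 1) = -bellSign 3 i := by
  obtain ⟨a, b⟩ := i
  fin_cases a <;> fin_cases b <;>
    norm_num [bellSign_one, bellSign_two, bellSign_three, show (1 : Fin 2) + 1 = 0 from rfl]

/-- The crosses of the grid of eigenvalues are given by the eigenvalues of the partial transpose. -/
lemma cross_eq {x : Fin 4 × Fin 4 → ℝ} (h0 : x (0, 0) = 1 / 4) (i j : Q) :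
    ∑ l, eigenvalue x (i, l) + ∑ l, eigenvalue x (l, j) - 2 * eigenvalue x (i, j) =
      1 / 2 - 2 * eigenvalue (transposedCoeff x) ((i.1 + 1, i.2 + 1), (j.1 + 1, j.2 + 1)) := by
  obtain ⟨h1, h2, h3⟩ := bellSign_flip i
  obtain ⟨h1', h2', h3'⟩ := bellSign_flip j
  rw [sum_eigenvalue_right, sum_eigenvalue_left, eigenvalue_eq, eigenvalue_transposedCoeff]
  simp only [h0, h1, h2, h3, h1', h2', h3']
  ring

lemma sum_eigenvalue {x : Fin 4 × Fin 4 → ℝ} (h0 : x (0, 0) = 1 / 4) :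
    ∑ i, ∑ j, eigenvalue x (i, j) = 1 := by
  obtain ⟨h1, h2, h3⟩ := sum_bellSign
  simp only [sum_eigenvalue_right, Finset.sum_add_distrib, ← Finset.sum_mul, h1, h2, h3, h0]
  norm_num [Fintype.card_prod]

/-- A Bloch-diagonal operator whose partial transpose is positive definite has rank at least
nine. -/
lemma nine_le_card {x : Fin 4 × Fin 4 → ℝ} (h0 : x (0, 0) = 1 / 4)
    (h : ∀ j, 0 < eigenvalue (transposedCoeff x) j) :
    9 ≤ (Finset.univ.filter fun j => eigenvalue x j ≠ 0).card := by
  let e : Fin 4 ≃ Q := (finProdFinEquiv (m := 2) (n := 2)).symm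
  have h1 : ∑ i, ∑ j, eigenvalue x (e i, e j) = 1 := by
    rw [← sum_eigenvalue h0, ← Equiv.sum_comp e]
    exact Finset.sum_congr rfl fun i _ => Equiv.sum_comp e fun j => eigenvalue x (e i, j)
  have h2 : ∑ i, ∑ j, (decide (eigenvalue x (e i, e j) = 0)).toNat < 8 := by
    refine sum_zeros_lt (p := fun i j => eigenvalue x (e i, e j)) h1 fun i j => ?_
    rw [Equiv.sum_comp e fun l => eigenvalue x (e i, l),
      Equiv.sum_comp e fun l => eigenvalue x (l, e j), cross_eq h0]
    linarith [h ((((e i).1 + 1, (e i).2 + 1), ((e j).1 + 1, (e j).2 + 1)) : Q × Q)]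
  have h3 : (Finset.univ.filter fun j => eigenvalue x j = 0).card =
      ∑ i, ∑ j, (decide (eigenvalue x (e i, e j) = 0)).toNat := by
    rw [Finset.card_filter, Fintype.sum_prod_type, ← Equiv.sum_comp e]
    refine Finset.sum_congr rfl fun i _ => ?_
    rw [← Equiv.sum_comp e]
    refine Finset.sum_congr rfl fun j _ => ?_
    by_cases h : eigenvalue x (e i, e j) = 0 <;> simp [h]
  have h4 := Finset.card_filter_add_card_filter_not (s := Finset.univ) fun j => eigenvalue x j = 0
  have h5 : (Finset.univ : Finset (Q × Q)).card = 16 := rfl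
  simp only [ne_eq]
  omega

/-! ### Bounds on the radius and on the rank -/

lemma sqrt_fifteen_bounds : 3.8729833 < √15 ∧ √15 < 3.8729834 := by
  constructor
  · exact Real.lt_sqrt_of_sq_lt (by norm_num)
  · exact (Real.sqrt_lt' (by norm_num)).2 (by norm_num)

lemma sqrt_sixteen : √(16 : ℝ) = 4 := by
  rw [show (16 : ℝ) = 4 ^ 2 by norm_num]
  exact Real.sqrt_sq (by norm_num)

lemma sqrt_ratio : √((16 - 1) / 16 : ℝ) = √15 / 4 := by
  rw [Real.sqrt_div (by norm_num), sqrt_sixteen]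
  norm_num

lemma sStar_eq : sStar * (12 * (4 + 5 * √15)) = 4 + 3 * √15 := by
  rw [sStar]
  exact div_mul_cancel₀ _ (by positivity)

lemma sStar_bounds : 0.055705 < sStar ∧ sStar < 0.055708 := by
  obtain ⟨h1, h2⟩ := sqrt_fifteen_bounds
  rw [sStar, lt_div_iff₀ (by positivity), div_lt_iff₀ (by positivity)]
  constructor <;> nlinarith

/-- The equation that determines `s*`: the least partially transposed eigenvalue `(1 - 12 s) / 16`
and the trace norm `1 / 4 + 15 s` allow the same radius. -/
lemma rStar_mul : rStar * (√15 / 4) = (1 - 12 * sStar) / 16 := by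
  rw [rStar]
  linear_combination 1 / 64 * sStar_eq

lemma mem_admissibleRadii (x : Fin 4 × Fin 4 → ℝ) (r : ℝ) :
    r ∈ admissibleRadii (blochDiagonal x) ↔ 0 ≤ r ∧
      (∀ j, r * (√15 / 4) ≤ eigenvalue (transposedCoeff x) j) ∧ 1 + 4 * r < ∑ k, |x k| := by
  change 0 ≤ r ∧ _ ∧ _ ↔ _
  rw [partialTranspose_blochDiagonal, le_minEigenvalue_blochDiagonal, traceNorm_realignment,
    sqrt_ratio, sqrt_sixteen, mul_comm r 4]

lemma coeff_zero_of_isState {x : Fin 4 × Fin 4 → ℝ} (h : IsState (blochDiagonal x)) :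
    x (0, 0) = 1 / 4 := by
  have := h.2
  rw [trace_blochDiagonal] at this
  have h' : (4 * x (0, 0) : ℝ) = 1 := by exact_mod_cast this
  linarith

/-- The optimal bound, and the bound on the number of zero eigenvalues in the case of equality. -/
lemma sum_abs_le {x : Fin 4 × Fin 4 → ℝ} (h : IsState (blochDiagonal x))
    (hμ : ∀ j, rStar * (√15 / 4) ≤ eigenvalue (transposedCoeff x) j)
    (hl : 1 + 4 * rStar ≤ ∑ k, |x k|) :
    ∑ k, |x k| ≤ 1 + 4 * rStar ∧
      10 ≤ (Finset.univ.filter fun j => eigenvalue x j ≠ 0).card := by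
  have h0 := coeff_zero_of_isState h
  obtain ⟨hs1, hs2⟩ := sStar_bounds
  have ht : 0.6684 < 12 * sStar := by linarith
  have ht' : 12 * sStar < 0.6685 := by linarith
  -- With this `t` the lower bound `r* √15 / 4` is `(1 - t) / 16`, and `8 (1 + 4 r*) - 2 = 10 t`.
  have hb := cutBounds_edgeWeight (t := 12 * sStar) h0 ((posSemidef_blochDiagonal x).1 h.1)
    fun j => by rw [← rStar_mul]; exact hμ j
  have hr : rStar = (15 * sStar - 3 / 4) / 4 := rfl
  have := sum_abs_bound (PatternBound.of_irreducible (patternBound_optimal ht ht')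
    (patternBound_of_mem ht ht')) hb (by rw [sum_abs_edgeWeight h0]; linarith)
  rw [sum_abs_edgeWeight h0] at this
  refine ⟨by linarith [this.1], ?_⟩
  have h2 := two_mul_card_le_tightCount h0
  have h4 := Finset.card_filter_add_card_filter_not (s := Finset.univ) fun j => eigenvalue x j = 0
  have h5 : (Finset.univ : Finset (Q × Q)).card = 16 := rfl
  simp only [ne_eq]
  omega

lemma rStar_pos : 0 < rStar := by
  rw [rStar]; linarith [sStar_bounds.1]

lemma le_rStar_of_mem {x : Fin 4 × Fin 4 → ℝ} (h : IsState (blochDiagonal x)) {r : ℝ}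
    (hr : r ∈ admissibleRadii (blochDiagonal x)) : r ≤ rStar := by
  obtain ⟨-, h2, h3⟩ := (mem_admissibleRadii x r).1 hr
  by_contra! hlt
  have := (sum_abs_le h (fun j => le_trans (by gcongr) (h2 j)) (by linarith)).1
  linarith

lemma hasMaximalRadius_le {ρ : BiOp} (hρ : IsBlochDiagonalState ρ) {r : ℝ}
    (hr : HasMaximalRadius ρ r) : r ≤ rStar := by
  obtain ⟨h, x, rfl⟩ := hρ
  exact hr.2 fun s hs => le_rStar_of_mem h hs

lemma ten_le_rank {ρ : BiOp} (hρ : IsBlochDiagonalState ρ) (hr : HasMaximalRadius ρ rStar) :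
    10 ≤ ρ.rank := by
  obtain ⟨h, x, rfl⟩ := hρ
  rw [rank_blochDiagonal]
  refine (sum_abs_le h (fun j => ?_) ?_).2
  -- The supremum need not be admissible, but it satisfies both conditions with weak inequalities:
  -- each of them says that some number bounds all admissible radii from above.
  · have : rStar ≤ eigenvalue (transposedCoeff x) j / (√15 / 4) := hr.2 fun s hs => by
      rw [le_div_iff₀ (by positivity)]
      exact ((mem_admissibleRadii x s).1 hs).2.1 j
    rwa [le_div_iff₀ (by positivity)] at this
  · have : rStar ≤ (∑ k, |x k| - 1) / 4 := hr.2 fun s hs => by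
      linarith [((mem_admissibleRadii x s).1 hs).2.2]
    linarith

lemma nine_le_rank {ρ : BiOp} (hρ : IsBlochDiagonalState ρ) {r : ℝ}
    (hr : r ∈ admissibleRadii ρ) (h0 : 0 < r) : 9 ≤ ρ.rank := by
  obtain ⟨h, x, rfl⟩ := hρ
  rw [rank_blochDiagonal]
  exact nine_le_card (coeff_zero_of_isState h) fun j =>
    lt_of_lt_of_le (by positivity) (((mem_admissibleRadii x r).1 hr).2.1 j)

/-! ### The explicit extremal states -/

lemma isBlochDiagonalState_blochDiagonal {x : Fin 4 × Fin 4 → ℝ} (h0 : x (0, 0) = 1 / 4)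
    (h : ∀ j, 0 ≤ eigenvalue x j) : IsBlochDiagonalState (blochDiagonal x) :=
  ⟨⟨(posSemidef_blochDiagonal x).2 h, by rw [trace_blochDiagonal, h0]; norm_num⟩, x, rfl⟩

lemma isBoundEntangled_blochDiagonal {x : Fin 4 × Fin 4 → ℝ} (h0 : x (0, 0) = 1 / 4)
    (h : ∀ j, 0 ≤ eigenvalue x j) (hμ : ∀ j, 0 ≤ eigenvalue (transposedCoeff x) j)
    (hl : 1 < ∑ k, |x k|) : IsBoundEntangled (blochDiagonal x) := by
  refine ⟨(isBlochDiagonalState_blochDiagonal h0 h).1, ?_, fun hs => ?_⟩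
  · rw [partialTranspose_blochDiagonal]
    exact (posSemidef_blochDiagonal _).2 hμ
  · exact absurd (sum_abs_le_of_isSeparable hs) (not_le.2 hl)

/-- The maximal radius if the bound on the trace norm is the active one. -/
lemma hasMaximalRadius_of_sum_eq {x : Fin 4 × Fin 4 → ℝ} {r : ℝ} (h0 : 0 < r)
    (hμ : ∀ j, r * (√15 / 4) ≤ eigenvalue (transposedCoeff x) j)
    (hl : ∑ k, |x k| = 1 + 4 * r) : HasMaximalRadius (blochDiagonal x) r := by
  have : admissibleRadii (blochDiagonal x) = Set.Ico 0 r := by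
    ext s
    rw [mem_admissibleRadii, hl, Set.mem_Ico]
    refine ⟨fun h => ⟨h.1, by linarith [h.2.2]⟩, fun h => ⟨h.1, fun j => ?_, by linarith [h.2]⟩⟩
    refine le_trans ?_ (hμ j)
    gcongr
    exact h.2.le
  rw [HasMaximalRadius, this]
  exact isLUB_Ico h0

/-- The maximal radius if the bound on the least eigenvalue is the active one. -/
lemma hasMaximalRadius_of_eigenvalue_eq {x : Fin 4 × Fin 4 → ℝ} {r : ℝ} (h0 : 0 < r)
    (hμ : ∀ j, r * (√15 / 4) ≤ eigenvalue (transposedCoeff x) j)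
    (he : ∃ j, eigenvalue (transposedCoeff x) j = r * (√15 / 4))
    (hl : 1 + 4 * r < ∑ k, |x k|) :
    r ∈ admissibleRadii (blochDiagonal x) ∧ HasMaximalRadius (blochDiagonal x) r := by
  have hr : r ∈ admissibleRadii (blochDiagonal x) := (mem_admissibleRadii x r).2 ⟨h0.le, hμ, hl⟩
  refine ⟨hr, IsGreatest.isLUB ⟨hr, fun s hs => ?_⟩⟩
  obtain ⟨j, hj⟩ := he
  have := ((mem_admissibleRadii x s).1 hs).2.1 j
  rw [hj] at this
  exact le_of_mul_le_mul_right this (by positivity)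

/-- Coefficients of an optimal state of rank ten. -/
def rankTenCoeff (k : Fin 4 × Fin 4) : ℝ :=
  ![![1 / 4, sStar, -sStar, sStar],
    ![-1 / 8 + 5 / 2 * sStar, -1 / 8 + 1 / 2 * sStar, -sStar, sStar],
    ![1 / 8 - 5 / 2 * sStar, -sStar, -1 / 8 + 1 / 2 * sStar, -sStar],
    ![1 / 8 - 5 / 2 * sStar, -sStar, sStar, 1 / 8 - 1 / 2 * sStar]] k.1 k.2

/-- Coefficients of a state of rank nine with positive radius. -/
def rankNineCoeff (k : Fin 4 × Fin 4) : ℝ :=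
  ![![1 / 4, -31 / 404, 19 / 404, 29 / 404],
    ![-9 / 404, 19 / 404, -31 / 404, 39 / 404],
    ![-9 / 404, 19 / 404, 29 / 404, -21 / 404],
    ![7 / 404, 43 / 404, 29 / 404, 19 / 404]] k.1 k.2

lemma optimalCoeff_eq (k : Fin 4 × Fin 4) : optimalCoeff k =
    ![![1 / 4, sStar, sStar, sStar], ![sStar, sStar, sStar, -sStar],
      ![sStar, sStar, -sStar, sStar], ![-sStar, sStar, -sStar, -sStar]] k.1 k.2 := by
  obtain ⟨a, b⟩ := k
  fin_cases a <;> fin_cases b <;> first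
    | exact if_pos rfl
    | exact (if_neg (by decide)).trans (if_pos (by decide))
    | exact (if_neg (by decide)).trans (if_neg (by decide))

lemma eigenvalue_optimalCoeff_nonneg (j : Q × Q) : 0 ≤ eigenvalue optimalCoeff j := by
  obtain ⟨h1, h2⟩ := sStar_bounds
  obtain ⟨⟨a, b⟩, c, d⟩ := j
  rw [eigenvalue_eq]
  simp only [optimalCoeff_eq, Matrix.cons_val]
  fin_cases a <;> fin_cases b <;> fin_cases c <;> fin_cases d <;>
    norm_num [bellSign_one, bellSign_two, bellSign_three] <;> linarith

lemma le_eigenvalue_optimalCoeff (j : Q × Q) :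
    rStar * (√15 / 4) ≤ eigenvalue (transposedCoeff optimalCoeff) j := by
  obtain ⟨h1, h2⟩ := sStar_bounds
  obtain ⟨⟨a, b⟩, c, d⟩ := j
  rw [rStar_mul, eigenvalue_transposedCoeff]
  simp only [optimalCoeff_eq, Matrix.cons_val]
  fin_cases a <;> fin_cases b <;> fin_cases c <;> fin_cases d <;>
    norm_num [bellSign_one, bellSign_two, bellSign_three] <;> linarith

lemma abs_optimalCoeff {k : Fin 4 × Fin 4} (hk : k ≠ (0, 0)) : |optimalCoeff k| = sStar := by
  have h : 0 < sStar := by linarith [sStar_bounds.1]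
  rw [optimalCoeff, if_neg hk]
  split_ifs
  · exact abs_of_pos h
  · rw [abs_neg, abs_of_pos h]

lemma sum_abs_optimalCoeff : ∑ k, |optimalCoeff k| = 1 + 4 * rStar := by
  have h0 : |optimalCoeff (0, 0)| = 1 / 4 := by norm_num [optimalCoeff]
  rw [sum_abs_eq, h0]
  repeat rw [abs_optimalCoeff (by decide)]
  rw [rStar]
  ring

lemma eigenvalue_rankTenCoeff_nonneg (j : Q × Q) : 0 ≤ eigenvalue rankTenCoeff j := by
  obtain ⟨h1, h2⟩ := sStar_bounds
  obtain ⟨⟨a, b⟩, c, d⟩ := j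
  rw [eigenvalue_eq]
  simp only [rankTenCoeff, Matrix.cons_val]
  fin_cases a <;> fin_cases b <;> fin_cases c <;> fin_cases d <;>
    norm_num [bellSign_one, bellSign_two, bellSign_three] <;> linarith

lemma le_eigenvalue_rankTenCoeff (j : Q × Q) :
    rStar * (√15 / 4) ≤ eigenvalue (transposedCoeff rankTenCoeff) j := by
  obtain ⟨h1, h2⟩ := sStar_bounds
  obtain ⟨⟨a, b⟩, c, d⟩ := j
  rw [rStar_mul, eigenvalue_transposedCoeff]
  simp only [rankTenCoeff, Matrix.cons_val]
  fin_cases a <;> fin_cases b <;> fin_cases c <;> fin_cases d <;>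
    norm_num [bellSign_one, bellSign_two, bellSign_three] <;> linarith

lemma sum_abs_rankTenCoeff : ∑ k, |rankTenCoeff k| = 1 + 4 * rStar := by
  obtain ⟨h1, h2⟩ := sStar_bounds
  rw [sum_abs_eq, rStar]
  simp only [rankTenCoeff, Matrix.cons_val]
  -- Three coefficients have absolute value `5 s* / 2 - 1 / 8` and three have `1 / 8 - s* / 2`;
  -- together they contribute `6 s*`, as if all six were `± s*`.
  rw [abs_of_pos (show (0 : ℝ) < 1 / 4 by norm_num), abs_neg,
      abs_of_pos (show 0 < sStar by linarith),
    abs_of_pos (show 0 < -1 / 8 + 5 / 2 * sStar by linarith),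
    abs_of_neg (show -1 / 8 + 1 / 2 * sStar < 0 by linarith),
    abs_of_neg (show 1 / 8 - 5 / 2 * sStar < 0 by linarith),
    abs_of_pos (show 0 < 1 / 8 - 1 / 2 * sStar by linarith)]
  ring

lemma eigenvalue_rankNineCoeff_nonneg (j : Q × Q) : 0 ≤ eigenvalue rankNineCoeff j := by
  obtain ⟨⟨a, b⟩, c, d⟩ := j
  rw [eigenvalue_eq]
  simp only [rankNineCoeff, Matrix.cons_val]
  fin_cases a <;> fin_cases b <;> fin_cases c <;> fin_cases d <;>
    norm_num [bellSign_one, bellSign_two, bellSign_three]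

/-- The least eigenvalue of the partial transpose of the rank-nine state is `5 / 404`, and this
constraint limits the radius to `√15 / 303`; the trace norm `227 / 202` leaves room. -/
lemma rankNine_mul : √15 / 303 * (√15 / 4) = 5 / 404 := by
  linear_combination 1 / 1212 * Real.mul_self_sqrt (show (0 : ℝ) ≤ 15 by norm_num)

lemma le_eigenvalue_rankNineCoeff (j : Q × Q) :
    √15 / 303 * (√15 / 4) ≤ eigenvalue (transposedCoeff rankNineCoeff) j := by
  obtain ⟨⟨a, b⟩, c, d⟩ := j
  rw [rankNine_mul, eigenvalue_transposedCoeff]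
  simp only [rankNineCoeff, Matrix.cons_val]
  fin_cases a <;> fin_cases b <;> fin_cases c <;> fin_cases d <;>
    norm_num [bellSign_one, bellSign_two, bellSign_three]

lemma eigenvalue_rankNineCoeff_eq :
    eigenvalue (transposedCoeff rankNineCoeff) ((1, 0), (1, 0)) = √15 / 303 * (√15 / 4) := by
  rw [rankNine_mul, eigenvalue_transposedCoeff]
  simp only [rankNineCoeff, Matrix.cons_val]
  norm_num [bellSign_one, bellSign_two, bellSign_three]

lemma sum_abs_rankNineCoeff : ∑ k, |rankNineCoeff k| = 227 / 202 := by
  rw [sum_abs_eq]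
  simp only [rankNineCoeff, Matrix.cons_val]
  norm_num [abs_of_pos, abs_div]

/-- The rank is bounded by the number of indices outside a set of zero eigenvalues. -/
lemma rank_le_of_forall_eq_zero {x : Fin 4 × Fin 4 → ℝ} (Z : Finset (Q × Q))
    (h : ∀ j ∈ Z, eigenvalue x j = 0) : (blochDiagonal x).rank ≤ Zᶜ.card := by
  rw [rank_blochDiagonal]
  refine Finset.card_le_card fun j hj => ?_
  rw [Finset.mem_compl]
  exact fun hZ => (Finset.mem_filter.1 hj).2 (h j hZ)

lemma rank_rankTen_le : (blochDiagonal rankTenCoeff).rank ≤ 10 := by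
  refine rank_le_of_forall_eq_zero {((0, 0), (1, 0)), ((0, 0), (1, 1)), ((1, 0), (0, 1)),
    ((1, 0), (1, 0)), ((1, 1), (0, 1)), ((1, 1), (1, 1))} ?_
  simp only [Finset.forall_mem_insert, Finset.mem_singleton, forall_eq, eigenvalue_eq]
  simp only [rankTenCoeff, Matrix.cons_val]
  norm_num [bellSign_one, bellSign_two, bellSign_three]
  refine ⟨?_, ?_, ?_, ?_, ?_, ?_⟩ <;> ring

lemma rank_rankNine_le : (blochDiagonal rankNineCoeff).rank ≤ 9 := by
  refine rank_le_of_forall_eq_zero {((0, 0), (1, 0)), ((0, 0), (1, 1)), ((0, 1), (0, 0)),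
    ((0, 1), (1, 1)), ((1, 0), (1, 0)), ((1, 1), (0, 0)), ((1, 1), (1, 0))} ?_
  simp only [Finset.forall_mem_insert, Finset.mem_singleton, forall_eq, eigenvalue_eq]
  simp only [rankNineCoeff, Matrix.cons_val]
  norm_num [bellSign_one, bellSign_two, bellSign_three]

lemma rankNine_mem_and_hasMaximalRadius :
    √15 / 303 ∈ admissibleRadii (blochDiagonal rankNineCoeff) ∧
      HasMaximalRadius (blochDiagonal rankNineCoeff) (√15 / 303) := by
  refine hasMaximalRadius_of_eigenvalue_eq (by positivity) le_eigenvalue_rankNineCoeff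
    ⟨_, eigenvalue_rankNineCoeff_eq⟩ ?_
  rw [sum_abs_rankNineCoeff]
  linarith [sqrt_fifteen_bounds.2]

lemma detectedByCCNR_blochDiagonal (x : Fin 4 × Fin 4 → ℝ) :
    DetectedByCCNR (blochDiagonal x) ↔ 1 < ∑ k, |x k| := by
  rw [DetectedByCCNR, traceNorm_realignment]

end BlochDiag

end

open BlochDiag in
theorem mainTheorem5 :
    -- the optimal radius over all Bloch-diagonal states, and the numerical values
    IsGreatest {r : ℝ | ∃ ρ : BlochDiag.BiOp,
        BlochDiag.IsBlochDiagonalState ρ ∧ BlochDiag.HasMaximalRadius ρ r} BlochDiag.rStar ∧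
    |BlochDiag.sStar - 0.05571| ≤ 0.000005 ∧
    |BlochDiag.rStar - 0.0214| ≤ 0.00005 ∧
    -- it is attained with all `|x_k| = s*`
    (BlochDiag.IsBlochDiagonalState (BlochDiag.blochDiagonal BlochDiag.optimalCoeff) ∧
      (∀ k, k ≠ (0, 0) → |BlochDiag.optimalCoeff k| = BlochDiag.sStar) ∧
      BlochDiag.HasMaximalRadius (BlochDiag.blochDiagonal BlochDiag.optimalCoeff)
        BlochDiag.rStar) ∧
    -- the minimal rank of the optimal states
    IsLeast {n : ℕ | ∃ ρ : BlochDiag.BiOp, BlochDiag.IsBlochDiagonalState ρ ∧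
        BlochDiag.IsBoundEntangled ρ ∧ BlochDiag.DetectedByCCNR ρ ∧
        BlochDiag.HasMaximalRadius ρ BlochDiag.rStar ∧ ρ.rank = n} 10 ∧
    -- the minimal rank of the states that admit some positive radius
    IsLeast {n : ℕ | ∃ ρ : BlochDiag.BiOp, BlochDiag.IsBlochDiagonalState ρ ∧
        BlochDiag.IsBoundEntangled ρ ∧ BlochDiag.DetectedByCCNR ρ ∧
        (∃ r ∈ BlochDiag.admissibleRadii ρ, 0 < r) ∧ ρ.rank = n} 9 ∧
    -- a state of rank 9 with radius approximately 0.0128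
    (∃ (ρ : BlochDiag.BiOp) (r : ℝ), BlochDiag.IsBlochDiagonalState ρ ∧
        BlochDiag.IsBoundEntangled ρ ∧ BlochDiag.DetectedByCCNR ρ ∧ ρ.rank = 9 ∧
        BlochDiag.HasMaximalRadius ρ r ∧ |r - 0.0128| ≤ 0.00005) := by
  have hr := rStar_pos
  obtain ⟨hs1, hs2⟩ := sStar_bounds
  obtain ⟨hq1, hq2⟩ := sqrt_fifteen_bounds
  have hopt : IsBlochDiagonalState (blochDiagonal optimalCoeff) :=
    isBlochDiagonalState_blochDiagonal (by simp [optimalCoeff]) eigenvalue_optimalCoeff_nonneg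
  have hoptr : HasMaximalRadius (blochDiagonal optimalCoeff) rStar :=
    hasMaximalRadius_of_sum_eq hr le_eigenvalue_optimalCoeff sum_abs_optimalCoeff
  have h10 : IsBlochDiagonalState (blochDiagonal rankTenCoeff) :=
    isBlochDiagonalState_blochDiagonal rfl eigenvalue_rankTenCoeff_nonneg
  have h10r : HasMaximalRadius (blochDiagonal rankTenCoeff) rStar :=
    hasMaximalRadius_of_sum_eq hr le_eigenvalue_rankTenCoeff sum_abs_rankTenCoeff
  have h10l : 1 < ∑ k, |rankTenCoeff k| := by rw [sum_abs_rankTenCoeff]; linarith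
  have h10e : IsBoundEntangled (blochDiagonal rankTenCoeff) :=
    isBoundEntangled_blochDiagonal rfl eigenvalue_rankTenCoeff_nonneg
      (fun j => le_trans (by positivity) (le_eigenvalue_rankTenCoeff j)) h10l
  have h9 : IsBlochDiagonalState (blochDiagonal rankNineCoeff) :=
    isBlochDiagonalState_blochDiagonal rfl eigenvalue_rankNineCoeff_nonneg
  obtain ⟨h9m, h9r⟩ := rankNine_mem_and_hasMaximalRadius
  have h9p : 0 < √15 / 303 := by positivity
  have h9l : 1 < ∑ k, |rankNineCoeff k| := by rw [sum_abs_rankNineCoeff]; norm_num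
  have h9e : IsBoundEntangled (blochDiagonal rankNineCoeff) :=
    isBoundEntangled_blochDiagonal rfl eigenvalue_rankNineCoeff_nonneg
      (fun j => le_trans (by positivity) (le_eigenvalue_rankNineCoeff j)) h9l
  have h9k := le_antisymm rank_rankNine_le (nine_le_rank h9 h9m h9p)
  refine ⟨⟨⟨_, hopt, hoptr⟩, ?_⟩, ?_, ?_, ⟨hopt, fun _ => abs_optimalCoeff, hoptr⟩,
    ⟨⟨_, h10, h10e, (detectedByCCNR_blochDiagonal _).2 h10l, h10r,
      le_antisymm rank_rankTen_le (ten_le_rank h10 h10r)⟩, ?_⟩,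
    ⟨⟨_, h9, h9e, (detectedByCCNR_blochDiagonal _).2 h9l, ⟨_, h9m, h9p⟩, h9k⟩, ?_⟩,
    _, _, h9, h9e, (detectedByCCNR_blochDiagonal _).2 h9l, h9k, h9r, ?_⟩
  · rintro r ⟨ρ, hρ, hρr⟩
    exact hasMaximalRadius_le hρ hρr
  · rw [abs_le]; constructor <;> linarith
  · rw [abs_le, rStar]; constructor <;> linarith
  · rintro n ⟨ρ, hρ, -, -, hρr, rfl⟩
    exact ten_le_rank hρ hρr
  · rintro n ⟨ρ, hρ, -, -, ⟨r, hr, h0⟩, rfl⟩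
    exact nine_le_rank hρ hr h0
  · rw [abs_le]; constructor <;> linarith
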